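/- Let $k$ be a number field with adele ring $\mathbb{A}$, let $|\cdot|$ be the adelic absolute value on $\mathbb{A}^\times$, put $\mathbb{A}^1=\{t\in\mathbb{A}^\times : |t|=1\}$, and let $\langle\cdot\rangle$ be a non-trivial continuous (unitary) character of $\mathbb{A}/k$. Let $C\subset\mathbb{A}^1$ be a compact subset that surjects onto $\mathbb{A}^1/k^\times$. For a real number $\lambda>0$ let $\underline\lambda\in\mathbb{A}^\times$ be the idele with component $\lambda^{1/[k:\mathbb{Q}]}$ at every infinite place and $1$ at every finite place. Let $\mathcal{S}(\mathbb{A}^n)$ be the space of Schwartz--Bruhat functions on $\mathbb{A}^n$. Let $d=2d_1$ be even and $d_1+2\le i<j\le d$. Identify a binary form $x_0v_1^d+x_1v_1^{d-1}v_2+\cdots+x_dv_2^d$ with the vector $x=(x_0,\dots,x_d)$, and let a $2\times 2$ matrix $g$ act by $(g\cdot f)(v)=f(vg)$, where $v=(v_1,v_2)$. Write $n(u)=\begin{pmatrix}1&0\\u&1\end{pmatrix}$ and $a(s_1,s_2)=\mathrm{diag}(s_1,s_2)$. For $$\tilde b=(\lambda,t,a(\underline\mu t_1,\underline\mu^{-1}t_2)\,n(u)),\qquad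 \lambda,\mu\in\mathbb{R}_{>0},\quad t,t_1,t_2\in\mathbb{A}^1,\quad u\in\mathbb{A},$$ put $\tilde b x=\underline\lambda\, t\cdot\big(a(\underline\mu t_1,\underline\mu^{-1}t_2)\,n(u)\,x\big)$ and $\gamma_j=t(\underline\mu t_1)^{d-j}(\underline\mu^{-1}t_2)^j$. Let $Y'$ be the set of all $x\in k^{d+1}$ whose coordinates vanish outside the positions $d_1,i,i+1,\dots,j-1$ and for which $x_{d_1}\neq 0$ and $x_i\ne 0$. For $x\in Y'$ let $q_{ij}(x,u)\in\mathbb{A}$ be the $j$-th coordinate of $n(u)x$ (minus $x_j=0$), and let $A_{\mathrm{st},ij}(\tilde b,x)\in\mathbb{A}^{j-d_1}$ be the vector of the coordinates $d_1,d_1+1,\dots,j-1$ of $\tilde bx$. For $\Psi\in\mathcal{S}(\mathbb{A}^{j-d_1+1})$ define $$\Theta_{\mathrm{st},ij}(\Psi,\tilde b)=\sum_{x\in Y'}\ \sum_{x_j\in k^\times}\Psi\big(A_{\mathrm{st},ij}(\tilde b,x),\ \underline\lambda^{-1}\gamma_j^{-1}x_j\big)\,\langle -x_j\,q_{ij}(x,u)\rangle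 .$$ Then this series converges absolutely for every $\tilde b$, and there exists a Schwartz--Bruhat function $0\le\Psi'\in\mathcal{S}(\mathbb{A}^2)$ such that $\sum_{x\in k^\times}\Psi'(\underline\lambda x,\underline\lambda\,\underline\mu^{-2}xu)$ converges for every $\tilde b$ and such that the following holds: for all real $N_1,N_2\ge1$ there is a constant $c$ with $$|\Theta_{\mathrm{st},ij}(\Psi,\tilde b)|\le c\,(\lambda^2\mu^{d-2i})^{-N_1}(\lambda\mu^{d-2j})^{N_2}\prod_{l=i+1}^{j-1}\sup(1,\lambda^{-1}\mu^{2l-d})\sum_{x_{d_1}\in k^\times}\Psi'(\underline\lambda x_{d_1},\ \underline\lambda\,\underline\mu^{-2}x_{d_1}u)$$ for all $\tilde b$ as above with $t,t_1,t_2\in C$. -/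

import Mathlib

open NumberField
open scoped BigOperators

namespace ShintaniGL2

noncomputable section

/-! ### Adeles, ideles, Schwartz–Bruhat functions -/

/-- The adele ring `𝔸` of the number field `K`. -/
abbrev Adele (K : Type*) [Field K] [NumberField K] := AdeleRing (𝓞 K) K

/-- The finite adele ring of the number field `K`. -/
abbrev FinAdele (K : Type*) [Field K] [NumberField K] :=
  IsDedekindDomain.FiniteAdeleRing (𝓞 K) K

/-- The adelic absolute value of an idele: the product over all places of the normalized absolute
values (the usual one at real places, its square at complex places, and the one with
`|ϖ|_v = (N v)⁻¹` at finite places; almost all factors are `1`). -/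
def ideleAbs {K : Type*} [Field K] [NumberField K] (a : (Adele K)ˣ) : ℝ :=
  (∏ v : InfinitePlace K, ‖(a : Adele K).1 v‖ ^ v.mult) *
    ∏ᶠ v : IsDedekindDomain.HeightOneSpectrum (𝓞 K), ‖(a : Adele K).2 v‖

/-- `𝔸¹`, the set of ideles of absolute value one. -/
def normOneIdeles (K : Type*) [Field K] [NumberField K] : Set (Adele K)ˣ :=
  {a | ideleAbs a = 1}

/-- The diagonal embedding `Kˣ → 𝔸ˣ`. -/
def principalIdele {K : Type*} [Field K] [NumberField K] (x : Kˣ) : (Adele K)ˣ :=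
  Units.map (algebraMap K (Adele K) : K →* Adele K) x

/-- The map sending a real number `r` to the adele which is `r` at every infinite place and `1` at
every finite place. -/
def realToAdele (K : Type*) [Field K] [NumberField K] : ℝ →* Adele K where
  toFun r := ((InfiniteAdeleRing.ringEquiv_mixedSpace K).symm
    ((fun _ => r), (fun _ => (r : ℂ))), (1 : FinAdele K))
  map_one' := by
    refine Prod.ext ?_ rfl
    change (InfiniteAdeleRing.ringEquiv_mixedSpace K).symm _ = 1
    rw [Complex.ofReal_one]
    exact map_one (InfiniteAdeleRing.ringEquiv_mixedSpace K).symm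
  map_mul' r s := by
    refine Prod.ext ?_ (one_mul (1 : FinAdele K)).symm
    change (InfiniteAdeleRing.ringEquiv_mixedSpace K).symm _ =
      (InfiniteAdeleRing.ringEquiv_mixedSpace K).symm _ *
        (InfiniteAdeleRing.ringEquiv_mixedSpace K).symm _
    rw [← map_mul, Complex.ofReal_mul]
    rfl

/-- For `r > 0`, the idele `r̲` with component `r ^ (1 / [K : ℚ])` at every infinite place and `1` at
every finite place, so that its adelic absolute value is `r`. -/
def realIdele (K : Type*) [Field K] [NumberField K] (r : ℝ) (hr : 0 < r) : (Adele K)ˣ :=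
  Units.map (realToAdele K)
    (Units.mk0 (r ^ (1 / (Module.finrank ℚ K : ℝ))) (Real.rpow_pos_of_pos hr _).ne')

open scoped Classical in
/-- The space `𝒮(𝔸ⁿ)` of Schwartz–Bruhat functions: the span of the products of a Schwartz function
of the infinite part (the infinite adeles being identified with `ℝ ^ r₁ × ℂ ^ r₂`) and a locally
constant, compactly supported function of the finite part. -/
def SchwartzBruhat (K : Type*) [Field K] [NumberField K] (n : ℕ) :
    Submodule ℂ ((Fin n → Adele K) → ℂ) :=
  Submodule.span ℂ {F | ∃ (f : SchwartzMap (Fin n → mixedEmbedding.mixedSpace K) ℂ)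
    (h : (Fin n → FinAdele K) → ℂ), IsLocallyConstant h ∧ HasCompactSupport h ∧
      ∀ x, F x = f (fun m => InfiniteAdeleRing.ringEquiv_mixedSpace K (x m).1) *
        h (fun m => (x m).2)}

/-! ### Binary forms -/

/-- The binary form `x₀ v₁ᵈ + x₁ v₁ᵈ⁻¹ v₂ + ⋯ + x_d v₂ᵈ` with coefficient vector `x`; the variables
`v₁`, `v₂` are `X 0`, `X 1`. -/
def binaryForm {R : Type*} [CommRing R] {d : ℕ} (x : Fin (d + 1) → R) : MvPolynomial (Fin 2) R :=
  ∑ i : Fin (d + 1), MvPolynomial.C (x i) * MvPolynomial.X 0 ^ (d - (i : ℕ)) *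
    MvPolynomial.X 1 ^ (i : ℕ)

/-- The action `(g · f)(v) = f(v g)` of two by two matrices on binary forms of degree `d`, in terms
of coefficient vectors; `v = (v₁, v₂)` is a row vector. -/
def formAct {R : Type*} [CommRing R] {d : ℕ} (g : Matrix (Fin 2) (Fin 2) R) (x : Fin (d + 1) → R) :
    Fin (d + 1) → R :=
  fun r => MvPolynomial.coeff (Finsupp.single 0 (d - (r : ℕ)) + Finsupp.single 1 (r : ℕ))
    (MvPolynomial.bind₁
      (fun c => ∑ a : Fin 2, MvPolynomial.X a * MvPolynomial.C (g a c)) (binaryForm x))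

/-- `n(u)`, the lower triangular unipotent matrix. -/
def lowerUnip {R : Type*} [CommRing R] (u : R) : Matrix (Fin 2) (Fin 2) R := !![1, 0; u, 1]

/-- The elements `b̃ = (λ, t, a(μ̲ t₁, μ̲⁻¹ t₂) n(u))` of `B̃_𝔸 = ℝ₊ × B⁰_𝔸`, where `λ, μ > 0`,
`t, t₁, t₂ ∈ 𝔸¹` and `u ∈ 𝔸`. -/
structure BorelElt (K : Type*) [Field K] [NumberField K] where
  lam : ℝ
  mu : ℝ
  lam_pos : 0 < lam
  mu_pos : 0 < mu
  t : (Adele K)ˣ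
  t₁ : (Adele K)ˣ
  t₂ : (Adele K)ˣ
  t_mem : t ∈ normOneIdeles K
  t₁_mem : t₁ ∈ normOneIdeles K
  t₂_mem : t₂ ∈ normOneIdeles K
  u : Adele K

namespace BorelElt

variable {K : Type*} [Field K] [NumberField K]

/-- The idele `λ̲`. -/
def lamIdele (b : BorelElt K) : (Adele K)ˣ := realIdele K b.lam b.lam_pos

/-- The idele `μ̲`. -/
def muIdele (b : BorelElt K) : (Adele K)ˣ := realIdele K b.mu b.mu_pos

/-- The `GL(2)`-component `a(μ̲ t₁, μ̲⁻¹ t₂) n(u)` of `b̃`. -/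
def matrix (b : BorelElt K) : Matrix (Fin 2) (Fin 2) (Adele K) :=
  Matrix.diagonal ![((b.muIdele * b.t₁ : (Adele K)ˣ) : Adele K),
    ((b.muIdele⁻¹ * b.t₂ : (Adele K)ˣ) : Adele K)] * lowerUnip b.u

/-- The action of `b̃` on `V_𝔸`: the matrix acts on forms, and `λ̲` and `t` act by
multiplication. -/
def act (b : BorelElt K) {d : ℕ} (x : Fin (d + 1) → Adele K) : Fin (d + 1) → Adele K :=
  fun r => ((b.lamIdele * b.t : (Adele K)ˣ) : Adele K) * formAct b.matrix x r

/-- `γ_j(t⁰)`, the weight of the `j`-th coordinate of a form of degree `d` at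
`t⁰ = (t, a(μ̲ t₁, μ̲⁻¹ t₂))`. -/
def weight (b : BorelElt K) (d j : ℕ) : (Adele K)ˣ :=
  b.t * (b.muIdele * b.t₁) ^ (d - j) * (b.muIdele⁻¹ * b.t₂) ^ j

end BorelElt

/-! ### The theta series -/

variable {K : Type*} [Field K] [NumberField K]

/-- A rational form as an adelic form. -/
def toAdelic {d : ℕ} (x : Fin (d + 1) → K) : Fin (d + 1) → Adele K :=
  fun r => algebraMap K (Adele K) (x r)

/-- The set of rational forms of degree `2 d₁` whose coordinates vanish outside the positions `d₁`
and `i, …, j - 1`, with non-zero coordinates at `d₁` and `i`. -/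
def stForms (K : Type*) [Field K] (d₁ : ℕ) (i j : Fin (2 * d₁ + 1)) :
    Set (Fin (2 * d₁ + 1) → K) :=
  {x | x ⟨d₁, by omega⟩ ≠ 0 ∧ x i ≠ 0 ∧
    ∀ m : Fin (2 * d₁ + 1), x m ≠ 0 → (m : ℕ) = d₁ ∨ (i ≤ m ∧ m < j)}

/-- `q_{ij}(x, u)`: the amount by which the `j`-th coordinate of `n(u) x` differs from that
of `x`. -/
def qShift {d : ℕ} (x : Fin (d + 1) → K) (u : Adele K) (j : Fin (d + 1)) : Adele K :=
  formAct (lowerUnip u) (toAdelic x) j - toAdelic x j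

/-- The coordinates `d₁, …, j - 1` of `b̃ x`, followed by `λ̲⁻¹ γ_j(t⁰)⁻¹ x_j`. -/
def thetaArg {d₁ : ℕ} (j : Fin (2 * d₁ + 1)) (b : BorelElt K) (x : Fin (2 * d₁ + 1) → K) (xj : Kˣ) :
    Fin ((j : ℕ) - d₁ + 1) → Adele K :=
  Fin.snoc (α := fun _ => Adele K)
    (fun m : Fin ((j : ℕ) - d₁) => b.act (toAdelic x) ⟨d₁ + (m : ℕ), by omega⟩)
    ((b.lamIdele⁻¹ * (b.weight (2 * d₁) j)⁻¹ * principalIdele xj : (Adele K)ˣ) : Adele K)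

/-- The term of the theta series that belongs to `x` and `x_j`. -/
def thetaTerm (ψ : AddChar (Adele K) Circle) {d₁ : ℕ} (i j : Fin (2 * d₁ + 1))
    (Ψ : (Fin ((j : ℕ) - d₁ + 1) → Adele K) → ℂ) (b : BorelElt K)
    (p : stForms K d₁ i j × Kˣ) : ℂ :=
  Ψ (thetaArg j b p.1 p.2) *
    (ψ (-(algebraMap K (Adele K) (p.2 : K) * qShift (p.1 : Fin (2 * d₁ + 1) → K) b.u j)) : ℂ)

/-- The theta series `Θ_{st,ij}(Ψ, b̃)`. -/
def thetaSt (ψ : AddChar (Adele K) Circle) {d₁ : ℕ} (i j : Fin (2 * d₁ + 1))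
    (Ψ : (Fin ((j : ℕ) - d₁ + 1) → Adele K) → ℂ) (b : BorelElt K) : ℂ :=
  ∑' p : stForms K d₁ i j × Kˣ, thetaTerm ψ i j Ψ b p

/-- The point `(λ̲ x, λ̲ μ̲⁻² x u)` of `𝔸²`. -/
def majorantArg (b : BorelElt K) (x : Kˣ) : Fin 2 → Adele K :=
  ![((b.lamIdele * principalIdele x : (Adele K)ˣ) : Adele K),
    ((b.lamIdele * b.muIdele ^ (-2 : ℤ) * principalIdele x : (Adele K)ˣ) : Adele K) * b.u]

end

end ShintaniGL2

/-!
Only absolute values enter: the character has modulus one and is discarded. Up to ideles from a fixed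
compact set, the `r`-th coordinate of `b̃ x` is `X_r = s_r (x_r + p_r)`, where `s_r` is the idele
attached to the scale `λ μ ^ (d - 2 r)` and `p_r` is an adele that depends only on `u` and on the
coordinates of `x` before `r`; the last argument of `Ψ` is likewise `s_j⁻¹ x_j`.

*Summation.* A function on the adeles that decays fast at infinity and lives on finite parts of bounded
denominator has `∑_{x ∈ K} f (r̲ (x + a)) ≪ max 1 r⁻¹`, uniformly in `a`
(`exists_tsum_decayWeight_le`): only one coset of `D⁻¹ 𝓞 K` contributes, and an integral basis
reduces the sum to one-dimensional ones. Because of the triangular shape of `p_r`, summing over `x_j`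
and then over `x_{j-1}, …, x_i` (`tsum_triangular_prod_le`) costs `max 1 s_j` and `max 1 s_r⁻¹` for
`i ≤ r < j`. The factors with `i < r < j` appear in the claim; those for `x_i` and `x_j` have to be
replaced by powers of `λ² μ ^ (d - 2 i)` and `λ μ ^ (d - 2 j)`.

*Bounds on the scales.* Since `X_{d₁}`, `X_{d₁+1}`, `X_{i-1}` and the part of `X_i` that comes from
`x_{d₁}` are binomial multiples of `x_{d₁}` times powers of `u`, a combination of `X_i X_{d₁}` and
`X_{d₁+1} X_{i-1}` is free of `u`: it is the idele attached to `λ² μ ^ (d - 2 i)` times a nonzero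
multiple of `x_i x_{d₁}` (`normCoord_relation`). A nonzero element of `K` with bounded denominator
cannot be small at all infinite places, so where `Ψ` does not vanish, a bound `R` for the
coordinates at infinity bounds `λ² μ ^ (d - 2 i)` polynomially. In the same way `x_{d₁} ≠ 0` bounds
`λ`, and `x_j ≠ 0` bounds `s_j⁻¹` (`exists_scale_le`). Hence a large negative power of `R`, supplied by
the rapid decay of `Ψ`, pays for the two unwanted factors and produces the powers with exponents `-N₁`
and `N₂` (`inv_pow_le_of_scale_le`).

*The majorant.* `Ψ` is dominated by a decreasing profile of the norm at infinity. One square root of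
the profile gives the negative powers of `R`; the other is dominated by a Schwartz–Bruhat function
`Ψ'` of `X_{d₁}` and of `X_{d₁+1} / d₁`, which are the arguments of `Ψ'` in the claim
(`exists_termwise_majorant`).

Convergence for an individual `b̃` is the same estimate applied to the compact set formed by its own
three ideles.
-/

namespace ShintaniGL2

noncomputable section

/-! ### Finite adeles with bounded denominators -/

section

open IsDedekindDomain HeightOneSpectrum nonZeroDivisors

variable {K : Type*} [Field K] [NumberField K]

/-- The integers of `K` are dense in the integers of the completion, so they surject onto its residue
field, which is therefore a quotient of the finite ring `𝓞 K ⧸ v`. -/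
instance finite_residueField_adicCompletionIntegers (v : HeightOneSpectrum (𝓞 K)) :
    Finite (IsLocalRing.ResidueField (v.adicCompletionIntegers K)) := by
  have : Finite (𝓞 K ⧸ v.asIdeal) := v.asIdeal.finiteQuotientOfFreeOfNeBot v.ne_bot
  let f : 𝓞 K →+* IsLocalRing.ResidueField (v.adicCompletionIntegers K) :=
    (IsLocalRing.residue _).comp (algebraMap (𝓞 K) (v.adicCompletionIntegers K))
  have key : ∀ a : v.adicCompletionIntegers K, Valued.v (a : v.adicCompletion K) < 1 →
      IsLocalRing.residue _ a = 0 := by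
    intro a ha
    rw [IsLocalRing.residue_eq_zero_iff, IsLocalRing.mem_maximalIdeal, mem_nonunits_iff,
      adicCompletionIntegers.isUnit_iff_valued_eq_one]
    exact ha.ne
  have hf : ∀ a ∈ v.asIdeal, f a = 0 := by
    intro a ha
    refine key _ ?_
    rw [algebraMap_adicCompletionIntegers_apply, valuedAdicCompletion_eq_valuation']
    exact (v.valuation_lt_one_iff_mem a).2 ha
  refine Finite.of_surjective (Ideal.Quotient.lift v.asIdeal f hf) ?_
  refine Ideal.Quotient.lift_surjective_of_surjective _ hf ?_
  intro y
  obtain ⟨x, rfl⟩ := IsLocalRing.residue_surjective y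
  have hopen : IsOpen {z : v.adicCompletion K | Valued.v (z - x) < 1} := by
    have : IsOpen {z : v.adicCompletion K | Valued.v z < (1 : WithZero (Multiplicative ℤ))} := by
      simpa only [← map_one (Valued.v (R := v.adicCompletion K)), Valuation.restrict_lt_iff]
        using Valued.isOpen_ball (v.adicCompletion K) (Valued.v.restrict 1)
    exact this.preimage (continuous_id.sub continuous_const)
  obtain ⟨k, hk⟩ := (denseRange_algebraMap K v).exists_mem_open hopen ⟨x, by simp⟩
  rw [algebraMap_adicCompletion] at hk
  have hk1 : v.valuation K k ≤ 1 := by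
    rw [← valuedAdicCompletion_eq_valuation']
    have h1 : ((k : K) : v.adicCompletion K) = (k - x) + x := by ring
    rw [h1]
    exact (Valued.v.map_add _ _).trans (max_le (le_of_lt hk) x.2)
  obtain ⟨a, ha⟩ := exists_valuation_sub_lt_of_integer v hk1 1
  refine ⟨a, ?_⟩
  rw [← sub_eq_zero]
  change IsLocalRing.residue _ (algebraMap (𝓞 K) (v.adicCompletionIntegers K) a) -
    IsLocalRing.residue _ x = 0
  rw [← map_sub]
  refine key _ ?_
  have h2 : ((algebraMap (𝓞 K) (v.adicCompletionIntegers K) a - x :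
      v.adicCompletionIntegers K) : v.adicCompletion K) =
      ((algebraMap (𝓞 K) K a - k : K) : v.adicCompletion K) + (k - x) := by
    simp only [AddSubgroupClass.coe_sub, algebraMap_adicCompletionIntegers_apply]
    have := map_sub (algebraMap K (v.adicCompletion K)) (algebraMap (𝓞 K) K a) k
    rw [algebraMap_adicCompletion] at this
    simp only [Function.comp_apply, Algebra.algebraMap_self, RingHom.id_apply] at this
    rw [this]; ring
  rw [h2]
  refine (Valued.v.map_add _ _).trans_lt (max_lt ?_ hk)
  rw [valuedAdicCompletion_eq_valuation']
  simpa using ha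

instance compactSpace_adicCompletionIntegers (v : HeightOneSpectrum (𝓞 K)) :
    CompactSpace (v.adicCompletionIntegers K) := by
  have h := Valued.integer.compactSpace_iff_completeSpace_and_isDiscreteValuationRing_and_finite_residueField
    (K := v.adicCompletion K) (Γ₀ := WithZero (Multiplicative ℤ))
  refine h.2 ⟨?_, inferInstanceAs (IsDiscreteValuationRing (v.adicCompletionIntegers K)),
    finite_residueField_adicCompletionIntegers v⟩
  have : IsClosed ((v.adicCompletionIntegers K : Set (v.adicCompletion K))) :=
    Valued.isClosed_valuationSubring _
  exact this.completeSpace_coe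

/-- The finite adeles with denominator dividing `D`: those `a` for which `D a` is integral at every
finite place. For `D = 0` these are all finite adeles. -/
def denomDvd (K : Type*) [Field K] [NumberField K] (D : ℕ) : Set (FinAdele K) :=
  {a | ∀ v, ((D : FinAdele K) * a) v ∈ v.adicCompletionIntegers K}

/-- The everywhere integral finite adeles. -/
def integralFinAdeles (K : Type*) [Field K] [NumberField K] : Subring (FinAdele K) where
  carrier := {a | ∀ v, a v ∈ v.adicCompletionIntegers K}
  mul_mem' ha hb v := mul_mem (ha v) (hb v)
  one_mem' v := one_mem (v.adicCompletionIntegers K)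
  add_mem' ha hb v := add_mem (ha v) (hb v)
  zero_mem' v := zero_mem (v.adicCompletionIntegers K)
  neg_mem' ha v := neg_mem (ha v)

theorem mem_denomDvd {D : ℕ} {a : FinAdele K} :
    a ∈ denomDvd K D ↔ (D : FinAdele K) * a ∈ integralFinAdeles K := Iff.rfl

theorem isOpen_integralFinAdeles : IsOpen (integralFinAdeles K : Set (FinAdele K)) :=
  RestrictedProduct.isOpen_forall_mem
    (A := fun v : HeightOneSpectrum (𝓞 K) => (v.adicCompletionIntegers K : Set (v.adicCompletion K)))
    fun _ => Valued.isOpen_valuationSubring _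

theorem isCompact_integralFinAdeles : IsCompact (integralFinAdeles K : Set (FinAdele K)) := by
  have : ∀ v : HeightOneSpectrum (𝓞 K),
      CompactSpace ((v.adicCompletionIntegers K : Set (v.adicCompletion K))) :=
    fun v => compactSpace_adicCompletionIntegers v
  have h := isCompact_range (RestrictedProduct.isEmbedding_structureMap
    (R := fun v : HeightOneSpectrum (𝓞 K) => v.adicCompletion K)
    (A := fun v : HeightOneSpectrum (𝓞 K) => (v.adicCompletionIntegers K : Set (v.adicCompletion K)))
    (𝓕 := Filter.cofinite)).continuous
  rw [RestrictedProduct.range_structureMap] at h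
  exact h

theorem isOpen_denomDvd (D : ℕ) : IsOpen (denomDvd K D) :=
  isOpen_integralFinAdeles.preimage (continuous_const.mul continuous_id)

theorem natCast_finAdele_mul_inv {D : ℕ} (hD : D ≠ 0) :
    (D : FinAdele K) * algebraMap K (FinAdele K) ((D : K)⁻¹) = 1 := by
  rw [← map_natCast (algebraMap K (FinAdele K)), ← map_mul,
    mul_inv_cancel₀ (Nat.cast_ne_zero.2 hD), map_one]

theorem isCompact_denomDvd {D : ℕ} (hD : D ≠ 0) : IsCompact (denomDvd K D) := by
  have h := (isCompact_integralFinAdeles (K := K)).image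
    (continuous_const_mul (algebraMap K (FinAdele K) ((D : K)⁻¹)))
  convert h using 1
  ext a
  rw [Set.mem_image]
  constructor
  · intro ha
    refine ⟨_, ha, ?_⟩
    rw [← mul_assoc, mul_comm _ (D : FinAdele K), natCast_finAdele_mul_inv hD, one_mul]
  · rintro ⟨b, hb, rfl⟩
    rw [mem_denomDvd, ← mul_assoc, natCast_finAdele_mul_inv hD, one_mul]
    exact hb

theorem isClosed_denomDvd (D : ℕ) : IsClosed (denomDvd K D) :=
  ((integralFinAdeles K).toAddSubgroup.isClosed_of_isOpen isOpen_integralFinAdeles).preimage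
    (continuous_const.mul continuous_id)

theorem denomDvd_mono {D D' : ℕ} (h : D ∣ D') : denomDvd K D ⊆ denomDvd K D' := by
  rintro a ha
  obtain ⟨e, rfl⟩ := h
  rw [mem_denomDvd] at *
  rw [Nat.cast_mul, mul_comm (D : FinAdele K), mul_assoc]
  exact mul_mem (natCast_mem _ e) ha

theorem mul_mem_denomDvd {D D' : ℕ} {a b : FinAdele K} (ha : a ∈ denomDvd K D)
    (hb : b ∈ denomDvd K D') : a * b ∈ denomDvd K (D * D') := by
  rw [mem_denomDvd] at *
  rw [Nat.cast_mul, mul_mul_mul_comm]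
  exact mul_mem ha hb

theorem sub_mem_denomDvd {D : ℕ} {a b : FinAdele K} (ha : a ∈ denomDvd K D)
    (hb : b ∈ denomDvd K D) : a - b ∈ denomDvd K D := by
  rw [mem_denomDvd] at *
  rw [mul_sub]
  exact sub_mem ha hb

theorem natCast_mul_mem_denomDvd {D : ℕ} (m : ℕ) {a : FinAdele K} (ha : a ∈ denomDvd K D) :
    (m : FinAdele K) * a ∈ denomDvd K D := by
  rw [mem_denomDvd] at *
  rw [mul_left_comm]
  exact mul_mem (natCast_mem _ m) ha

theorem mem_denomDvd_of_natCast_mul_mem {D m : ℕ} {a : FinAdele K}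
    (ha : (m : FinAdele K) * a ∈ denomDvd K D) : a ∈ denomDvd K (D * m) := by
  rw [mem_denomDvd] at *
  rwa [Nat.cast_mul, mul_assoc]

theorem exists_natCast_dvd {r : 𝓞 K} (hr : r ≠ 0) : ∃ D : ℕ, D ≠ 0 ∧ r ∣ (D : 𝓞 K) := by
  refine ⟨Ideal.absNorm (Ideal.span {r}), ?_, ?_⟩
  · rw [Ne, Ideal.absNorm_eq_zero_iff, Ideal.span_singleton_eq_bot]
    exact hr
  · rw [← Ideal.mem_span_singleton]
    exact Ideal.absNorm_mem _

/-- Each of the finitely many components that are not integral is made integral by a nonzero element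
of `𝓞 K`; the product of these elements divides a positive integer. -/
theorem exists_mem_denomDvd (a : FinAdele K) : ∃ D : ℕ, D ≠ 0 ∧ a ∈ denomDvd K D := by
  classical
  have hfin : {v | ¬ a v ∈ v.adicCompletionIntegers K}.Finite := a.2
  choose b hb hab using fun v => adicCompletion.mul_nonZeroDivisor_mem_adicCompletionIntegers v (a v)
  obtain ⟨D, hD, c, hc⟩ := exists_natCast_dvd
    (Finset.prod_ne_zero_iff.2 fun v (_ : v ∈ hfin.toFinset) => nonZeroDivisors.ne_zero (hb v))
  refine ⟨D, hD, fun v => ?_⟩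
  have hcast : (D : FinAdele K) v = algebraMap (𝓞 K) (v.adicCompletion K) (D : 𝓞 K) := by
    rw [← map_natCast (algebraMap K (FinAdele K)), map_natCast (algebraMap (𝓞 K) _)]
    exact map_natCast (algebraMap K (v.adicCompletion K)) D
  change (D : FinAdele K) v * a v ∈ _
  rw [hcast]
  have hint : ∀ r : 𝓞 K, algebraMap (𝓞 K) (v.adicCompletion K) r ∈ v.adicCompletionIntegers K := by
    exact fun r => coe_mem_adicCompletionIntegers v r
  by_cases hv : a v ∈ v.adicCompletionIntegers K
  · exact mul_mem (hint _) hv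
  · rw [hc, ← Finset.mul_prod_erase _ _ (hfin.mem_toFinset.2 hv), map_mul, map_mul, mul_comm,
      ← mul_assoc, ← mul_assoc]
    exact mul_mem (mul_mem (hab v) (hint _)) (hint _)

/-- The open sets `denomDvd K D` with `D ≠ 0` exhaust the finite adeles and are directed by
divisibility. -/
theorem IsCompact.exists_subset_denomDvd {s : Set (FinAdele K)} (hs : IsCompact s) :
    ∃ D : ℕ, D ≠ 0 ∧ s ⊆ denomDvd K D := by
  obtain ⟨t, ht⟩ := hs.elim_finite_subcover (fun D : {D : ℕ // D ≠ 0} => denomDvd K D.1)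
    (fun D => isOpen_denomDvd _) (fun a _ => by
      obtain ⟨D, hD, ha⟩ := exists_mem_denomDvd a
      exact Set.mem_iUnion.2 ⟨⟨D, hD⟩, ha⟩)
  refine ⟨∏ D ∈ t, D.1, Finset.prod_ne_zero_iff.2 fun D _ => D.2, fun a ha => ?_⟩
  obtain ⟨D, hD, haD⟩ := Set.mem_iUnion₂.1 (ht ha)
  exact denomDvd_mono (Finset.dvd_prod_of_mem _ hD) haD

theorem exists_algebraMap_eq_of_mem_denomDvd {D : ℕ} {x : K}
    (hx : algebraMap K (FinAdele K) x ∈ denomDvd K D) :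
    ∃ r : 𝓞 K, algebraMap (𝓞 K) K r = D * x := by
  refine HeightOneSpectrum.mem_integers_of_valuation_le_one K (D * x) fun v => ?_
  have := hx v
  rw [← map_natCast (algebraMap K (FinAdele K)), ← map_mul, FiniteAdeleRing.algebraMap_apply,
    mem_adicCompletionIntegers, valuedAdicCompletion_eq_valuation'] at this
  exact this

end

/-! ### Iterated sums and sums over the integers -/

section

open scoped ENNReal

/-- Summing out the last variable repeatedly bounds a triangular sum of products. -/
theorem tsum_triangular_prod_le {α : Type*} (P : (l : ℕ) → (Fin l → α) → α → ℝ≥0∞) (c : ℕ → ℝ≥0∞)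
    (h : ∀ l z, ∑' w, P l z w ≤ c l) (q : ℕ) :
    ∑' z : Fin q → α, ∏ l : Fin q, P l (fun m => z (m.castLE l.2.le)) (z l) ≤
      ∏ l ∈ Finset.range q, c l := by
  induction q with
  | zero => simp
  | succ q ih =>
    rw [← (Fin.snocEquiv fun _ : Fin (q + 1) => α).tsum_eq, ENNReal.tsum_prod', ENNReal.tsum_comm,
      Finset.prod_range_succ]
    have key : ∀ (z : Fin q → α) (w : α), (∏ l : Fin (q + 1), P l
        (fun m => (Fin.snocEquiv fun _ : Fin (q + 1) => α) (w, z) (m.castLE l.2.le))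
        ((Fin.snocEquiv fun _ : Fin (q + 1) => α) (w, z) l)) =
        (∏ l : Fin q, P l (fun m => z (m.castLE l.2.le)) (z l)) * P q z w := by
      intro z w
      rw [Fin.prod_univ_castSucc]
      have hs : ∀ m : Fin q,
          (Fin.snocEquiv fun _ : Fin (q + 1) => α) (w, z) m.castSucc = z m :=
        fun m => Fin.snoc_castSucc (α := fun _ => α) w z m
      congr 1
      · refine Finset.prod_congr rfl fun l _ => ?_
        rw [hs]
        congr 1
        funext m
        exact hs (m.castLE l.2.le)
      · have hl : (Fin.snocEquiv fun _ : Fin (q + 1) => α) (w, z) (Fin.last q) = w :=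
          Fin.snoc_last (α := fun _ => α) w z
        rw [hl]
        change P q _ w = _
        congr 1
        funext m
        exact hs m
    simp_rw [key, ENNReal.tsum_mul_left]
    calc _ ≤ ∑' z : Fin q → α, (∏ l : Fin q, P l (fun m => z (m.castLE l.2.le)) (z l)) * c q :=
          ENNReal.tsum_le_tsum fun z => by gcongr; exact h q z
      _ ≤ _ := by rw [ENNReal.tsum_mul_right]; gcongr

theorem tsum_pi_prod_le {ι α : Type*} [Fintype ι] (f : ι → α → ℝ≥0∞) (c : ℝ≥0∞)
    (h : ∀ i, ∑' w, f i w ≤ c) :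
    ∑' z : ι → α, ∏ i, f i (z i) ≤ c ^ Fintype.card ι := by
  classical
  let e := Fintype.equivFin ι
  rw [← (Equiv.arrowCongr e.symm (Equiv.refl α)).tsum_eq]
  have key : ∀ z : Fin (Fintype.card ι) → α,
      ∏ i, f i ((Equiv.arrowCongr e.symm (Equiv.refl α)) z i) =
      ∏ l : Fin (Fintype.card ι), (fun (l : ℕ) (_ : Fin l → α) (w : α) =>
        if hl : l < Fintype.card ι then f (e.symm ⟨l, hl⟩) w else 0) l
        (fun m => z (m.castLE l.2.le)) (z l) := by
    intro z
    rw [← e.prod_comp]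
    refine Finset.prod_congr rfl fun i _ => ?_
    simp
  simp_rw [key]
  refine (tsum_triangular_prod_le (fun (l : ℕ) (_ : Fin l → α) (w : α) =>
    if hl : l < Fintype.card ι then f (e.symm ⟨l, hl⟩) w else 0) (fun _ => c) ?_
    (Fintype.card ι)).trans (le_of_eq (by simp))
  intro l z
  by_cases hl : l < Fintype.card ι
  · simpa [hl] using h _
  · simp [hl]

/-- One-dimensional lattice sums of scale `1`, uniformly in the translation. -/
theorem exists_tsum_int_le :
    ∃ c : ℝ, 0 < c ∧ ∀ a : ℝ, ∑' z : ℤ, ENNReal.ofReal (1 + ((z : ℝ) + a) ^ 2)⁻¹ ≤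
      ENNReal.ofReal c := by
  have hsum : Summable fun z : ℤ => (1 + (z : ℝ) ^ 2)⁻¹ := by
    have h := (Real.summable_one_div_int_add_rpow (1 / 2) 2).2 (by norm_num)
    refine Summable.of_nonneg_of_le (fun z => by positivity) (fun z => ?_) (h.mul_left 2)
    have hz : (z : ℝ) + 1 / 2 ≠ 0 := by
      intro h0
      have : (2 * z + 1 : ℝ) = 0 := by linarith
      have : (2 * z + 1 : ℤ) = 0 := by exact_mod_cast this
      omega
    have hz2 : 0 < ((z : ℝ) + 1 / 2) ^ 2 := by positivity
    rw [Real.rpow_two, sq_abs, mul_one_div, inv_eq_one_div, div_le_div_iff₀ (by positivity) hz2]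
    nlinarith [sq_nonneg ((z : ℝ) - 1 / 2)]
  refine ⟨3 * ∑' z : ℤ, (1 + (z : ℝ) ^ 2)⁻¹, ?_, fun a => ?_⟩
  · have := hsum.tsum_pos (fun z => by positivity) 0 (by positivity)
    positivity
  · rw [← (Equiv.addRight (-⌊a⌋)).tsum_eq, ← tsum_mul_left,
      ENNReal.ofReal_tsum_of_nonneg (fun z => by positivity) (hsum.mul_left 3)]
    refine ENNReal.tsum_le_tsum fun z => ENNReal.ofReal_le_ofReal ?_
    have h0 := Int.fract_nonneg a
    have h1 := (Int.fract_lt_one a).le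
    have : (((Equiv.addRight (-⌊a⌋)) z : ℤ) : ℝ) + a = z + Int.fract a := by
      simp only [Equiv.coe_addRight, Int.cast_add, Int.cast_neg, Int.fract]; ring
    rw [this, ← div_eq_mul_inv, inv_eq_one_div, div_le_div_iff₀ (by positivity) (by positivity)]
    nlinarith [sq_nonneg ((z : ℝ) + 2 * Int.fract a), mul_nonneg h0 (sub_nonneg.2 h1)]

/-- One-dimensional lattice sums, uniformly in the translation and the scale. The case of scale
at least `1` follows from scale `1`, and for a smaller scale `ρ` the integers are split into
`⌈ρ⁻¹⌉` residue classes, on each of which the scale is at least `1`. -/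
theorem exists_tsum_int_scale_le :
    ∃ c : ℝ, 0 < c ∧ ∀ ρ : ℝ, 0 < ρ → ∀ a : ℝ,
      ∑' z : ℤ, ENNReal.ofReal (1 + (ρ * ((z : ℝ) + a)) ^ 2)⁻¹ ≤
        ENNReal.ofReal (c * max 1 ρ⁻¹) := by
  obtain ⟨c, hc, h⟩ := exists_tsum_int_le
  refine ⟨2 * c, by positivity, fun ρ hρ a => ?_⟩
  have big : ∀ ρ : ℝ, 1 ≤ ρ → ∀ a : ℝ,
      ∑' z : ℤ, ENNReal.ofReal (1 + (ρ * ((z : ℝ) + a)) ^ 2)⁻¹ ≤ ENNReal.ofReal c := by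
    intro ρ hρ a
    refine (ENNReal.tsum_le_tsum fun z => ENNReal.ofReal_le_ofReal ?_).trans (h a)
    gcongr (1 + ?_)⁻¹
    rw [mul_pow]
    exact le_mul_of_one_le_left (sq_nonneg _) (one_le_pow₀ hρ)
  obtain ⟨N, hN⟩ : ∃ N : ℕ, N = ⌈ρ⁻¹⌉₊ := ⟨_, rfl⟩
  have hN0 : N ≠ 0 := by rw [hN]; exact (Nat.ceil_pos.2 (inv_pos.2 hρ)).ne'
  have : NeZero N := ⟨hN0⟩
  have hNρ : 1 ≤ ρ * N := by
    have := Nat.le_ceil ρ⁻¹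
    rw [← hN] at this
    calc (1 : ℝ) = ρ * ρ⁻¹ := (mul_inv_cancel₀ hρ.ne').symm
      _ ≤ _ := by gcongr
  have hNle : (N : ℝ) ≤ 2 * max 1 ρ⁻¹ := by
    have h1 := (Nat.ceil_lt_add_one (inv_pos.2 hρ).le).le
    rw [← hN] at h1
    linarith [le_max_left 1 ρ⁻¹, le_max_right 1 ρ⁻¹]
  rw [← (Int.divModEquiv N).symm.tsum_eq, ENNReal.tsum_prod', ENNReal.tsum_comm]
  calc _ ≤ ∑' r : Fin N, ENNReal.ofReal c := by
        refine ENNReal.tsum_le_tsum fun r => ?_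
        refine le_trans (le_of_eq ?_) (big (ρ * N) hNρ (((r : ℕ) + a) / N))
        refine tsum_congr fun z => ?_
        congr 4
        simp only [Int.divModEquiv, Equiv.coe_fn_symm_mk]
        push_cast
        have : (N : ℝ) ≠ 0 := Nat.cast_ne_zero.2 hN0
        field_simp
        ring
    _ = ENNReal.ofReal (N * c) := by
        rw [tsum_fintype, Finset.sum_const, Finset.card_univ, Fintype.card_fin, nsmul_eq_mul,
          ENNReal.ofReal_mul (Nat.cast_nonneg _), ENNReal.ofReal_natCast]
    _ ≤ _ := ENNReal.ofReal_le_ofReal (by nlinarith)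

end

/-! ### Sums over the lattice `K` in the adeles -/

section

open scoped Classical ENNReal
open mixedEmbedding

variable {K : Type*} [Field K] [NumberField K]

/-- The infinite part of an adele, as an element of `ℝ ^ r₁ × ℂ ^ r₂`. -/
def archPart (K : Type*) [Field K] [NumberField K] : Adele K →+* mixedSpace K where
  toFun a := InfiniteAdeleRing.ringEquiv_mixedSpace K a.1
  map_one' := map_one (InfiniteAdeleRing.ringEquiv_mixedSpace K)
  map_mul' a b := map_mul (InfiniteAdeleRing.ringEquiv_mixedSpace K) a.1 b.1
  map_zero' := map_zero (InfiniteAdeleRing.ringEquiv_mixedSpace K)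
  map_add' a b := map_add (InfiniteAdeleRing.ringEquiv_mixedSpace K) a.1 b.1

/-- The finite part of an adele. -/
def finPart (K : Type*) [Field K] [NumberField K] : Adele K →+* FinAdele K where
  toFun a := a.2
  map_one' := rfl
  map_mul' _ _ := rfl
  map_zero' := rfl
  map_add' _ _ := rfl

theorem archPart_algebraMap (x : K) :
    archPart K (algebraMap K (Adele K) x) = mixedEmbedding K x :=
  (InfiniteAdeleRing.mixedEmbedding_eq_algebraMap_comp K).symm

theorem finPart_algebraMap (x : K) :
    finPart K (algebraMap K (Adele K) x) = algebraMap K (FinAdele K) x := rfl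

theorem continuous_archPart : Continuous (archPart K) := by
  have h : Continuous fun a : InfiniteAdeleRing K => InfiniteAdeleRing.ringEquiv_mixedSpace K a := by
    refine Continuous.prodMk (continuous_pi fun v => ?_) (continuous_pi fun v => ?_)
    · exact (InfinitePlace.Completion.isometry_extensionEmbeddingOfIsReal v.2).continuous.comp
        (continuous_apply v.1)
    · exact (InfinitePlace.Completion.isometry_extensionEmbedding v.1).continuous.comp
        (continuous_apply v.1)
  exact h.comp continuous_fst

theorem continuous_finPart : Continuous (finPart K) := continuous_snd

theorem archPart_realIdele (r : ℝ) (hr : 0 < r) :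
    archPart K (realIdele K r hr : (Adele K)ˣ) =
      (r ^ (1 / (Module.finrank ℚ K : ℝ))) • (1 : mixedSpace K) := by
  have : archPart K (realIdele K r hr : (Adele K)ˣ) =
      ((fun _ => r ^ (1 / (Module.finrank ℚ K : ℝ))),
        (fun _ => ((r ^ (1 / (Module.finrank ℚ K : ℝ)) : ℝ) : ℂ))) :=
    RingEquiv.apply_symm_apply _ _
  rw [this]
  ext <;> simp

theorem finPart_realIdele (r : ℝ) (hr : 0 < r) :
    finPart K (realIdele K r hr : (Adele K)ˣ) = 1 := rfl

theorem norm_archPart_realIdele_mul (r : ℝ) (hr : 0 < r) (a : Adele K) :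
    ‖archPart K ((realIdele K r hr : (Adele K)ˣ) * a)‖ =
      r ^ (1 / (Module.finrank ℚ K : ℝ)) * ‖archPart K a‖ := by
  rw [map_mul, archPart_realIdele, smul_one_mul, _root_.norm_smul, Real.norm_of_nonneg
    (Real.rpow_nonneg hr.le _)]

theorem finPart_realIdele_mul (r : ℝ) (hr : 0 < r) (a : Adele K) :
    finPart K ((realIdele K r hr : (Adele K)ˣ) * a) = finPart K a := by
  rw [map_mul, finPart_realIdele, one_mul]

theorem realIdele_mul (r s : ℝ) (hr : 0 < r) (hs : 0 < s) :
    realIdele K r hr * realIdele K s hs = realIdele K (r * s) (mul_pos hr hs) := by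
  rw [realIdele, realIdele, realIdele, ← map_mul]
  congr 1
  ext
  simp [Real.mul_rpow hr.le hs.le]

theorem realIdele_inv (r : ℝ) (hr : 0 < r) :
    (realIdele K r hr)⁻¹ = realIdele K r⁻¹ (inv_pos.2 hr) := by
  rw [realIdele, realIdele, ← map_inv]
  congr 1
  ext
  simp [Real.inv_rpow hr.le]

theorem realIdele_zpow (r : ℝ) (hr : 0 < r) (k : ℤ) :
    (realIdele K r hr) ^ k = realIdele K (r ^ k) (zpow_pos hr k) := by
  rw [realIdele, realIdele, ← map_zpow]
  congr 1
  ext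
  simp only [Units.val_zpow_eq_zpow_val, Units.val_mk0]
  rw [← Real.rpow_intCast, ← Real.rpow_intCast, ← Real.rpow_mul hr.le, ← Real.rpow_mul hr.le,
    mul_comm]

theorem norm_natCast_mul (m : ℕ) (v : mixedSpace K) : ‖(m : mixedSpace K) * v‖ = m * ‖v‖ := by
  rw [← nsmul_eq_mul, ← Nat.cast_smul_eq_nsmul ℝ, _root_.norm_smul, Real.norm_natCast]

/-- A nonzero element of `K` with bounded denominator is bounded away from zero at infinity. -/
theorem one_le_mul_norm_mixedEmbedding {D : ℕ} {x : K} (hx : x ≠ 0) (hD : D ≠ 0)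
    (h : algebraMap K (FinAdele K) x ∈ denomDvd K D) : 1 ≤ D * ‖mixedEmbedding K x‖ := by
  obtain ⟨r, hr⟩ := exists_algebraMap_eq_of_mem_denomDvd h
  have hr0 : r ≠ 0 := by
    rintro rfl
    rw [map_zero] at hr
    exact mul_ne_zero (Nat.cast_ne_zero.2 hD) hx hr.symm
  have h1 : (D : ℝ) * ‖mixedEmbedding K x‖ = ‖mixedEmbedding K (r : K)‖ := by
    rw [show (r : K) = D * x from hr, map_mul, map_natCast, norm_natCast_mul]
  rw [h1]
  by_contra! hlt
  have hpl : ∀ w : InfinitePlace K, w (r : K) < 1 := fun w => by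
    rw [← normAtPlace_apply]
    refine lt_of_le_of_lt ?_ hlt
    rw [norm_eq_sup'_normAtPlace]
    exact Finset.le_sup' (fun w => normAtPlace w (mixedEmbedding K (r : K))) (Finset.mem_univ w)
  obtain ⟨w⟩ := (inferInstance : Nonempty (InfinitePlace K))
  exact absurd (InfinitePlace.one_le_of_lt_one (w := w) hr0 fun z _ => hpl z) (not_le.2 (hpl w))

/-- A weight on the adeles: `(1 + ‖a_∞‖)⁻ᴹ` where the denominator of the finite part divides `D`,
and `0` elsewhere. -/
def decayWeight (D M : ℕ) (a : Adele K) : ℝ :=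
  if finPart K a ∈ denomDvd K D then ((1 + ‖archPart K a‖) ^ M)⁻¹ else 0

theorem decayWeight_nonneg (D M : ℕ) (a : Adele K) : 0 ≤ decayWeight D M a := by
  unfold decayWeight
  split_ifs <;> positivity

/-- The lattice sum on which all estimates rest. The elements of `K` that contribute lie in one coset
of `D⁻¹ 𝓞 K`; in coordinates with respect to an integral basis the sum is dominated by a product of
`[K : ℚ]` one-dimensional sums of scale `r ^ (1 / [K : ℚ])`. -/
theorem exists_tsum_decayWeight_le {D : ℕ} (hD : D ≠ 0) :
    ∃ c : ℝ, 0 < c ∧ ∀ (r : ℝ) (hr : 0 < r) (a : Adele K),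
      ∑' x : K, ENNReal.ofReal (decayWeight D (2 * Module.finrank ℚ K)
        (((realIdele K r hr : (Adele K)ˣ) : Adele K) * (algebraMap K (Adele K) x + a))) ≤
      ENNReal.ofReal (c * max 1 r⁻¹) := by
  obtain ⟨c, hc, hsum⟩ := exists_tsum_int_scale_le
  set n := Module.finrank ℚ K with hn
  have hn0 : 0 < n := Module.finrank_pos
  let ι := Module.Free.ChooseBasisIndex ℤ (𝓞 K)
  have hcard : Fintype.card ι = n := by
    rw [← Module.finrank_eq_card_chooseBasisIndex, RingOfIntegers.rank]
  have hDpos : (0 : ℝ) < D := Nat.cast_pos.2 (Nat.pos_of_ne_zero hD)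
  obtain ⟨L, hL1, hL⟩ : ∃ L : ℝ, 1 ≤ L ∧ ∀ (i : ι) (v : mixedSpace K),
      |(latticeBasis K).repr v i| ≤ L * ‖v‖ := by
    let B : ι → (mixedSpace K →L[ℝ] ℝ) := fun i =>
      LinearMap.toContinuousLinearMap ((latticeBasis K).coord i)
    refine ⟨1 + ∑ i, ‖B i‖, by simp; positivity, fun i v => ?_⟩
    refine ((B i).le_opNorm v).trans ?_
    gcongr
    have := Finset.single_le_sum (f := fun i => ‖B i‖) (fun i _ => norm_nonneg _)
      (Finset.mem_univ i)
    linarith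
  have hLD : 1 ≤ L * D := one_le_mul_of_one_le_of_one_le hL1
    (Nat.one_le_cast.2 (Nat.pos_of_ne_zero hD))
  refine ⟨(c * (L * D)) ^ n, by positivity, fun r hr a => ?_⟩
  by_cases hex : ∃ x : K, finPart K (algebraMap K (Adele K) x + a) ∈ denomDvd K D
  swap
  · push Not at hex
    rw [ENNReal.tsum_eq_zero.2 fun x => ?_]
    · exact zero_le
    · rw [decayWeight, finPart_realIdele_mul, if_neg (hex x), ENNReal.ofReal_zero]
  obtain ⟨x₀, hx₀⟩ := hex
  set ρ := r ^ (1 / (n : ℝ)) with hρ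
  have hρpos : 0 < ρ := Real.rpow_pos_of_pos hr _
  let f : K → ℝ≥0∞ := fun x => ENNReal.ofReal (decayWeight D (2 * n)
    (((realIdele K r hr : (Adele K)ˣ) : Adele K) * (algebraMap K (Adele K) x + a)))
  let bas := RingOfIntegers.basis K
  -- the coset of `D⁻¹ 𝓞 K` that contains all `x` with a nonzero contribution
  let g : (ι → ℤ) → K := fun z => x₀ + (D : K)⁻¹ * (bas.equivFun.symm z : 𝓞 K)
  have hg : Function.Injective g := fun z z' h => by
    have h1 := mul_left_cancel₀ (inv_ne_zero (Nat.cast_ne_zero.2 hD)) (add_left_cancel h)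
    exact bas.equivFun.symm.injective (RingOfIntegers.ext h1)
  have hsupp : Function.support f ⊆ Set.range g := by
    intro x hx
    have hx' : finPart K (algebraMap K (Adele K) x + a) ∈ denomDvd K D := by
      by_contra hne
      refine hx ?_
      simp only [f]
      rw [decayWeight, finPart_realIdele_mul, if_neg hne, ENNReal.ofReal_zero]
    have hdiff := sub_mem_denomDvd hx' hx₀
    rw [← map_sub, add_sub_add_right_eq_sub, ← map_sub, finPart_algebraMap] at hdiff
    obtain ⟨s, hs⟩ := exists_algebraMap_eq_of_mem_denomDvd hdiff
    refine ⟨bas.equivFun s, ?_⟩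
    simp only [g, LinearEquiv.symm_apply_apply]
    rw [show (s : K) = D * (x - x₀) from hs, inv_mul_cancel_left₀ (Nat.cast_ne_zero.2 hD)]
    ring
  change ∑' x : K, f x ≤ _
  rw [← hg.tsum_eq hsupp]
  let b : ι → ℝ := fun i =>
    D * (latticeBasis K).repr (mixedEmbedding K x₀ + archPart K a) i
  have hcoord : ∀ z i, (latticeBasis K).repr (mixedEmbedding K (g z) + archPart K a) i =
      ((z i : ℝ) + b i) / D := by
    intro z i
    have h1 : mixedEmbedding K (g z) + archPart K a =
        (mixedEmbedding K x₀ + archPart K a) +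
          (D : ℝ)⁻¹ • mixedEmbedding K ((bas.equivFun.symm z : 𝓞 K) : K) := by
      have h0 : mixedEmbedding K ((D : K)⁻¹ * ((bas.equivFun.symm z : 𝓞 K) : K)) =
          (D : ℝ)⁻¹ • mixedEmbedding K ((bas.equivFun.symm z : 𝓞 K) : K) := by
        rw [eq_inv_smul_iff₀ hDpos.ne', Nat.cast_smul_eq_nsmul, nsmul_eq_mul,
          ← map_natCast (mixedEmbedding K), ← map_mul,
          mul_inv_cancel_left₀ (Nat.cast_ne_zero.2 hD)]
      simp only [g]
      rw [map_add, h0]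
      abel
    rw [h1, map_add, Finsupp.add_apply, map_smul, Finsupp.smul_apply, latticeBasis_repr_apply,
      integralBasis_repr_apply]
    have h2 : bas.repr (bas.equivFun.symm z) i = z i := by
      rw [← Module.Basis.equivFun_apply, LinearEquiv.apply_symm_apply]
    rw [show (RingOfIntegers.basis K) = bas from rfl, h2]
    simp only [b, smul_eq_mul, eq_intCast, Rat.cast_intCast]
    field_simp
    ring
  -- each lattice coordinate is at most `L` times the norm, so one factor `(1 + ρ ‖·‖)²` is available
  -- for each of the `n` coordinates
  have hterm : ∀ z, f (g z) ≤ ∏ i, ENNReal.ofReal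
      (1 + (ρ / (L * D) * ((z i : ℝ) + b i)) ^ 2)⁻¹ := by
    intro z
    rw [← ENNReal.ofReal_prod_of_nonneg fun i _ => by positivity]
    refine ENNReal.ofReal_le_ofReal ?_
    have hle : decayWeight D (2 * n) (((realIdele K r hr : (Adele K)ˣ) : Adele K) *
        (algebraMap K (Adele K) (g z) + a)) ≤
        ((1 + ρ * ‖mixedEmbedding K (g z) + archPart K a‖) ^ (2 * n))⁻¹ := by
      rw [decayWeight, norm_archPart_realIdele_mul, map_add (archPart K), archPart_algebraMap]
      split_ifs
      · exact le_rfl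
      · positivity
    refine hle.trans ?_
    rw [Finset.prod_inv_distrib]
    refine inv_anti₀ (by positivity) ?_
    rw [pow_mul, ← hcard, ← Finset.card_univ, ← Finset.prod_const]
    refine Finset.prod_le_prod (fun i _ => by positivity) fun i _ => ?_
    have h1 := hL i (mixedEmbedding K (g z) + archPart K a)
    rw [hcoord] at h1
    set N := ‖mixedEmbedding K (g z) + archPart K a‖
    have h2 : |ρ / (L * D) * ((z i : ℝ) + b i)| ≤ ρ * N := by
      have : ρ / (L * D) * ((z i : ℝ) + b i) = ρ / L * (((z i : ℝ) + b i) / D) := by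
        field_simp
      rw [this, abs_mul, abs_of_pos (by positivity)]
      calc ρ / L * |((z i : ℝ) + b i) / D| ≤ ρ / L * (L * N) := by gcongr
        _ = ρ * N := by field_simp
    have h3 : 0 ≤ ρ * N := by positivity
    have h4 := sq_le_sq' (by linarith [abs_le.1 h2]) (abs_le.1 h2).2
    nlinarith
  calc _ ≤ ∑' z : ι → ℤ, ∏ i, ENNReal.ofReal (1 + (ρ / (L * D) * ((z i : ℝ) + b i)) ^ 2)⁻¹ :=
        ENNReal.tsum_le_tsum hterm
    _ ≤ (ENNReal.ofReal (c * max 1 (ρ / (L * D))⁻¹)) ^ n := by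
        rw [← hcard]
        exact tsum_pi_prod_le
          (fun i (w : ℤ) => ENNReal.ofReal (1 + (ρ / (L * D) * ((w : ℝ) + b i)) ^ 2)⁻¹) _
          fun i => hsum _ (by positivity) (b i)
    _ ≤ _ := by
        rw [← ENNReal.ofReal_pow (by positivity)]
        refine ENNReal.ofReal_le_ofReal ?_
        have h5 : (max 1 r⁻¹) = (max 1 ρ⁻¹) ^ n := by
          have hρn : ρ ^ n = r := by
            rw [hρ, one_div, Real.rpow_inv_natCast_pow hr.le hn0.ne']
          rcases le_total 1 ρ with h | h
          · rw [max_eq_left (inv_le_one_of_one_le₀ h), one_pow, max_eq_left]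
            rw [← hρn]
            exact inv_le_one_of_one_le₀ (one_le_pow₀ h)
          · rw [max_eq_right ((one_le_inv₀ hρpos).2 h), max_eq_right, inv_pow, hρn]
            rw [← hρn]
            exact (one_le_inv₀ (by positivity)).2 (pow_le_one₀ hρpos.le h)
        rw [h5, ← mul_pow]
        refine pow_le_pow_left₀ (by positivity) ?_ _
        rw [mul_assoc]
        refine mul_le_mul_of_nonneg_left ?_ hc.le
        rw [inv_div, div_eq_mul_inv]
        refine max_le (one_le_mul_of_one_le_of_one_le hLD (le_max_left _ _)) ?_
        gcongr
        exact le_max_right _ _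

end

/-! ### Rapidly decaying profiles and Schwartz majorants -/

section

open scoped Convolution ContDiff
open MeasureTheory

/-- A nonincreasing nonnegative function on the line that decays at `+∞` faster than any power. -/
structure IsRapidProfile (φ : ℝ → ℝ) : Prop where
  antitone : Antitone φ
  nonneg : ∀ r, 0 ≤ φ r
  decay : ∀ N : ℕ, ∃ C : ℝ, ∀ r, 0 ≤ r → (1 + r) ^ N * φ r ≤ C

/-- Smoothing a rapidly decaying function by a bump function supported in the unit ball keeps the rapid
decay and extends it to all derivatives, since these fall on the bump function. -/
theorem exists_pow_mul_iteratedDeriv_convolution_le {ψ : ℝ → ℝ} (hψ : LocallyIntegrable ψ)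
    (φ : ℝ → ℝ) (hψφ : ∀ x t, |x - t| ≤ 1 → ‖ψ t‖ ≤ φ |x|)
    (hφ : ∀ k : ℕ, ∃ C, ∀ x : ℝ, |x| ^ k * φ |x| ≤ C) (k n : ℕ) :
    ∀ ρ : ℝ → ℝ, ContDiff ℝ ∞ ρ → tsupport ρ ⊆ Metric.closedBall 0 1 →
      ∃ C, ∀ x, ‖x‖ ^ k *
        ‖iteratedDeriv n (ψ ⋆[ContinuousLinearMap.mul ℝ ℝ, volume] ρ) x‖ ≤ C := by
  induction n with
  | zero =>
    intro ρ hρ hsupp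
    have hcomp : HasCompactSupport ρ :=
      (isCompact_closedBall (0 : ℝ) 1).of_isClosed_subset (isClosed_tsupport ρ) hsupp
    obtain ⟨C, hC⟩ := hφ k
    have hint : Integrable ρ := hρ.continuous.integrable_of_hasCompactSupport hcomp
    refine ⟨C * ∫ t, ‖ρ t‖, fun x => ?_⟩
    rw [iteratedDeriv_zero, convolution_def]
    have hb : ‖∫ t, (ContinuousLinearMap.mul ℝ ℝ) (ψ t) (ρ (x - t))‖ ≤
        ∫ t, φ |x| * ‖ρ (x - t)‖ := by
      refine norm_integral_le_of_norm_le ((hint.norm.comp_sub_left x).const_mul _) ?_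
      refine Filter.Eventually.of_forall fun t => ?_
      rw [ContinuousLinearMap.mul_apply', norm_mul]
      by_cases h : |x - t| ≤ 1
      · exact mul_le_mul_of_nonneg_right (hψφ x t h) (norm_nonneg _)
      · have : ρ (x - t) = 0 := by
          by_contra hne
          exact h (by simpa using hsupp (subset_tsupport ρ hne))
        simp [this]
    rw [integral_const_mul, integral_sub_left_eq_self (fun t => ‖ρ t‖) volume x] at hb
    calc _ ≤ ‖x‖ ^ k * (φ |x| * ∫ t, ‖ρ t‖) := by gcongr
      _ = (|x| ^ k * φ |x|) * ∫ t, ‖ρ t‖ := by rw [Real.norm_eq_abs]; ring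
      _ ≤ _ := mul_le_mul_of_nonneg_right (hC x) (integral_nonneg fun _ => norm_nonneg _)
  | succ n ih =>
    intro ρ hρ hsupp
    have hcomp : HasCompactSupport ρ :=
      (isCompact_closedBall (0 : ℝ) 1).of_isClosed_subset (isClosed_tsupport ρ) hsupp
    have hd : deriv (ψ ⋆[ContinuousLinearMap.mul ℝ ℝ, volume] ρ) =
        ψ ⋆[ContinuousLinearMap.mul ℝ ℝ, volume] deriv ρ := funext fun x =>
      (hcomp.hasDerivAt_convolution_right _ hψ (hρ.of_le (by simp)) x).deriv
    rw [iteratedDeriv_succ', hd]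
    refine ih (deriv ρ) ?_ ?_
    · exact (contDiff_infty_iff_deriv.1 hρ).2
    · exact (closure_minimal support_deriv_subset (isClosed_tsupport ρ)).trans hsupp

/-- A rapidly decaying profile is dominated on `[0, ∞)` by a nonnegative Schwartz function: convolve
an even, slightly shifted copy of the profile with a bump function. -/
theorem IsRapidProfile.exists_schwartz_real {φ : ℝ → ℝ} (hφ : IsRapidProfile φ) :
    ∃ h : SchwartzMap ℝ ℝ, ∀ r, 0 ≤ r → φ r ≤ h r := by
  let ψ : ℝ → ℝ := fun t => φ (|t| - 1)
  have hψm : Measurable ψ := hφ.antitone.measurable.comp (by fun_prop)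
  have hψb : ∀ t, ‖ψ t‖ ≤ φ (-1) := fun t => by
    rw [Real.norm_of_nonneg (hφ.nonneg _)]
    exact hφ.antitone (by linarith [abs_nonneg t])
  have hψ : LocallyIntegrable ψ :=
    (locallyIntegrable_const (φ (-1))).mono hψm.aestronglyMeasurable
      (Filter.Eventually.of_forall fun t => (hψb t).trans (Real.le_norm_self _))
  let bump : ContDiffBump (0 : ℝ) := ⟨1 / 2, 1, by norm_num, by norm_num⟩
  let ρ : ℝ → ℝ := bump.normed volume
  have hρ : ContDiff ℝ ∞ ρ := bump.contDiff_normed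
  have hsupp : tsupport ρ ⊆ Metric.closedBall 0 1 := by
    rw [ContDiffBump.tsupport_normed_eq]
  have hcomp : HasCompactSupport ρ := bump.hasCompactSupport_normed
  have hdec := exists_pow_mul_iteratedDeriv_convolution_le hψ (fun r => φ (r - 2))
    (fun x t h => by
      rw [Real.norm_of_nonneg (hφ.nonneg _)]
      refine hφ.antitone ?_
      have := abs_sub_abs_le_abs_sub x t
      linarith)
    (fun k => by
      obtain ⟨C, hC⟩ := hφ.decay k
      refine ⟨2 ^ k * max C (φ (-2)), fun x => ?_⟩
      rcases le_total 2 |x| with h | h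
      · calc |x| ^ k * φ (|x| - 2) ≤ (2 * (1 + (|x| - 2))) ^ k * φ (|x| - 2) := by
              have := hφ.nonneg (|x| - 2)
              gcongr
              linarith
          _ = 2 ^ k * ((1 + (|x| - 2)) ^ k * φ (|x| - 2)) := by rw [mul_pow]; ring
          _ ≤ _ := by
              gcongr
              exact (hC _ (by linarith)).trans (le_max_left _ _)
      · refine mul_le_mul (by gcongr) ?_ (hφ.nonneg _) (by positivity)
        exact (hφ.antitone (by linarith [abs_nonneg x])).trans (le_max_right _ _))
  refine ⟨⟨ψ ⋆[ContinuousLinearMap.mul ℝ ℝ, volume] ρ,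
    hcomp.contDiff_convolution_right _ hψ hρ, fun k n => ?_⟩, fun r hr => ?_⟩
  · simp_rw [norm_iteratedFDeriv_eq_norm_iteratedDeriv]
    exact hdec k n ρ hρ hsupp
  · change φ r ≤ ∫ t, ψ t * ρ (r - t)
    have hone : ∫ t, φ r * ρ (r - t) = φ r := by
      rw [integral_const_mul, integral_sub_left_eq_self ρ volume r, bump.integral_normed, mul_one]
    have hρint : Integrable fun t => ρ (r - t) :=
      (hρ.continuous.integrable_of_hasCompactSupport hcomp).comp_sub_left r
    rw [← hone]
    refine integral_mono (hρint.const_mul _) ?_ fun t => ?_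
    · exact hρint.bdd_mul hψm.aestronglyMeasurable (Filter.Eventually.of_forall hψb)
    · by_cases h : |r - t| ≤ 1
      · refine mul_le_mul_of_nonneg_right (hφ.antitone ?_) (bump.nonneg_normed _)
        have := abs_sub_abs_le_abs_sub t r
        rw [abs_sub_comm t r, abs_of_nonneg hr] at this
        linarith
      · have : ρ (r - t) = 0 := by
          by_contra hne
          exact h (by simpa using hsupp (subset_tsupport ρ hne))
        simp [this]

/-- A rapidly decaying radial function on a finite-dimensional space is dominated by a Schwartz
function. -/
theorem IsRapidProfile.exists_schwartz {E : Type*} [NormedAddCommGroup E] [NormedSpace ℝ E]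
    [FiniteDimensional ℝ E] {φ : ℝ → ℝ} (hφ : IsRapidProfile φ) :
    ∃ (g : SchwartzMap E ℂ) (g₀ : E → ℝ), (∀ x, g x = g₀ x) ∧ ∀ x, φ ‖x‖ ≤ g₀ x := by
  -- the norm need not be smooth, so the one-variable majorant, taken for the profile `φ (√r / A)`, is
  -- composed with the squared norm in Euclidean coordinates
  let e : E ≃L[ℝ] EuclideanSpace ℝ (Fin (Module.finrank ℝ E)) := toEuclidean
  set A : ℝ := 1 + ‖(e : E →L[ℝ] EuclideanSpace ℝ (Fin (Module.finrank ℝ E)))‖ with hA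
  have hA1 : 1 ≤ A := le_add_of_nonneg_right (norm_nonneg _)
  have hA0 : 0 < A := by linarith
  have hφ₂ : IsRapidProfile fun r => φ (√r / A) := by
    refine ⟨fun r s h => hφ.antitone (by gcongr), fun r => hφ.nonneg _, fun N => ?_⟩
    obtain ⟨C, hC⟩ := hφ.decay (2 * N)
    refine ⟨(A ^ 2) ^ N * C, fun r hr => ?_⟩
    have h1 : 1 + r ≤ A ^ 2 * (1 + √r / A) ^ 2 := by
      rw [← mul_pow, mul_add, mul_one, mul_div_cancel₀ _ hA0.ne']
      nlinarith [Real.sq_sqrt hr, Real.sqrt_nonneg r]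
    calc (1 + r) ^ N * φ (√r / A) ≤ (A ^ 2 * (1 + √r / A) ^ 2) ^ N * φ (√r / A) := by
          have := hφ.nonneg (√r / A)
          gcongr
      _ = (A ^ 2) ^ N * ((1 + √r / A) ^ (2 * N) * φ (√r / A)) := by
          rw [mul_pow, ← pow_mul (1 + √r / A)]; ring
      _ ≤ _ := by
          gcongr
          exact hC _ (by positivity)
  obtain ⟨h, hh⟩ := hφ₂.exists_schwartz_real
  have hgrow : (fun x : E => ‖e x‖ ^ 2).HasTemperateGrowth :=
    (Function.hasTemperateGrowth_norm_sq
      (EuclideanSpace ℝ (Fin (Module.finrank ℝ E)))).comp e.hasTemperateGrowth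
  have hup : ∃ (k : ℕ) (C : ℝ), ∀ x : E, ‖x‖ ≤ C * (1 + ‖(‖e x‖ ^ 2 : ℝ)‖) ^ k := by
    refine ⟨1, ‖(e.symm : EuclideanSpace ℝ (Fin (Module.finrank ℝ E)) →L[ℝ] E)‖, fun x => ?_⟩
    have h1 := (e.symm : EuclideanSpace ℝ (Fin (Module.finrank ℝ E)) →L[ℝ] E).le_opNorm (e x)
    simp only [ContinuousLinearEquiv.coe_coe, ContinuousLinearEquiv.symm_apply_apply] at h1
    refine h1.trans ?_
    rw [pow_one, Real.norm_of_nonneg (sq_nonneg _)]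
    gcongr
    nlinarith [sq_nonneg (‖e x‖ - 1), norm_nonneg (e x)]
  refine ⟨SchwartzMap.compCLM ℝ hgrow hup (SchwartzMap.postcompCLM Complex.ofRealCLM h),
    fun x => h (‖e x‖ ^ 2), fun x => rfl, fun x => ?_⟩
  refine le_trans (hφ.antitone ?_) (hh _ (sq_nonneg _))
  rw [Real.sqrt_sq (norm_nonneg _), div_le_iff₀ hA0, mul_comm]
  refine ((e : E →L[ℝ] EuclideanSpace ℝ (Fin (Module.finrank ℝ E))).le_opNorm x).trans ?_
  gcongr
  linarith

/-- The profile is the supremum of `‖f‖` outside the ball of radius `r`. -/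
theorem SchwartzMap.exists_rapidProfile {E : Type*} [NormedAddCommGroup E] [NormedSpace ℝ E]
    (f : SchwartzMap E ℂ) : ∃ φ, IsRapidProfile φ ∧ ∀ x, ‖f x‖ ≤ φ ‖x‖ := by
  have hb : ∀ N : ℕ, ∃ C, 0 ≤ C ∧ ∀ x, (1 + ‖x‖) ^ N * ‖f x‖ ≤ C := fun N => by
    have h := fun x => SchwartzMap.one_add_le_sup_seminorm_apply (𝕜 := ℝ) (m := (N, 0))
      le_rfl le_rfl f x
    simp only [norm_iteratedFDeriv_zero] at h
    exact ⟨_, le_trans (by positivity) (h 0), h⟩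
  obtain ⟨C, hC0, hC⟩ := hb 0
  simp only [pow_zero, one_mul] at hC
  let F : ℝ → E → ℝ := fun r x => if r ≤ ‖x‖ then ‖f x‖ else 0
  have hF0 : ∀ r x, 0 ≤ F r x := fun r x => by simp only [F]; split_ifs <;> positivity
  have hbdd : ∀ r, BddAbove (Set.range (F r)) := by
    rintro r
    refine ⟨C, ?_⟩
    rintro _ ⟨x, rfl⟩
    simp only [F]
    split_ifs
    exacts [hC x, hC0]
  refine ⟨fun r => ⨆ x, F r x, ⟨fun r s h => ?_, fun r => Real.iSup_nonneg (hF0 r), fun N => ?_⟩,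
    fun x => ?_⟩
  · refine ciSup_mono (hbdd r) fun x => ?_
    simp only [F]
    split_ifs with h1 h2
    exacts [le_rfl, absurd (h.trans h1) h2, norm_nonneg _, le_rfl]
  · obtain ⟨D, hD0, hD⟩ := hb N
    refine ⟨D, fun r hr => ?_⟩
    rw [Real.mul_iSup_of_nonneg (by positivity)]
    refine ciSup_le fun x => ?_
    simp only [F]
    split_ifs with h
    · exact le_trans (by gcongr) (hD x)
    · simpa using hD0
  · refine le_trans (le_of_eq ?_) (le_ciSup (hbdd ‖x‖) x)
    simp [F]

theorem IsRapidProfile.add {φ₁ φ₂ : ℝ → ℝ} (h₁ : IsRapidProfile φ₁) (h₂ : IsRapidProfile φ₂) :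
    IsRapidProfile fun r => φ₁ r + φ₂ r := by
  refine ⟨fun r s h => add_le_add (h₁.antitone h) (h₂.antitone h),
    fun r => add_nonneg (h₁.nonneg r) (h₂.nonneg r), fun N => ?_⟩
  obtain ⟨C₁, hC₁⟩ := h₁.decay N
  obtain ⟨C₂, hC₂⟩ := h₂.decay N
  exact ⟨C₁ + C₂, fun r hr => by rw [mul_add]; exact add_le_add (hC₁ r hr) (hC₂ r hr)⟩

theorem IsRapidProfile.const_mul {φ : ℝ → ℝ} (h : IsRapidProfile φ) {c : ℝ} (hc : 0 ≤ c) :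
    IsRapidProfile fun r => c * φ r := by
  refine ⟨fun r s hrs => mul_le_mul_of_nonneg_left (h.antitone hrs) hc,
    fun r => mul_nonneg hc (h.nonneg r), fun N => ?_⟩
  obtain ⟨C, hC⟩ := h.decay N
  exact ⟨c * C, fun r hr => by rw [mul_left_comm]; exact mul_le_mul_of_nonneg_left (hC r hr) hc⟩

theorem IsRapidProfile.comp_mul {φ : ℝ → ℝ} (h : IsRapidProfile φ) {κ : ℝ} (hκ : 0 < κ) :
    IsRapidProfile fun r => φ (κ * r) := by
  refine ⟨fun r s hrs => h.antitone (by gcongr), fun r => h.nonneg _, fun N => ?_⟩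
  obtain ⟨C, hC⟩ := h.decay N
  refine ⟨(1 + κ⁻¹) ^ N * C, fun r hr => ?_⟩
  have h1 : 1 + r ≤ (1 + κ⁻¹) * (1 + κ * r) := by
    have : κ⁻¹ * (κ * r) = r := by field_simp
    have h2 : 0 ≤ κ * r := by positivity
    have h3 := inv_pos.2 hκ
    nlinarith
  calc (1 + r) ^ N * φ (κ * r) ≤ ((1 + κ⁻¹) * (1 + κ * r)) ^ N * φ (κ * r) := by
        have := h.nonneg (κ * r)
        gcongr
    _ = (1 + κ⁻¹) ^ N * ((1 + κ * r) ^ N * φ (κ * r)) := by rw [mul_pow]; ring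
    _ ≤ _ := by
        gcongr
        exact hC _ (by positivity)

theorem IsRapidProfile.sqrt {φ : ℝ → ℝ} (h : IsRapidProfile φ) :
    IsRapidProfile fun r => √(φ r) := by
  refine ⟨fun r s hrs => Real.sqrt_le_sqrt (h.antitone hrs), fun r => Real.sqrt_nonneg _,
    fun N => ?_⟩
  obtain ⟨C, hC⟩ := h.decay (2 * N)
  refine ⟨√C, fun r hr => Real.le_sqrt_of_sq_le ?_⟩
  rw [mul_pow, Real.sq_sqrt (h.nonneg r), ← pow_mul, mul_comm N]
  exact hC r hr

end

/-! ### The action on binary forms and bounds for Schwartz–Bruhat functions -/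

section

open scoped Classical
open mixedEmbedding

section Forms

variable {R : Type*} [CommRing R] {d : ℕ}

/-- The amount by which the `r`-th coordinate of `n(u) x` differs from `x_r`; it involves only the
coordinates before `r`. -/
def unipShift (u : R) (x : Fin (d + 1) → R) (r : Fin (d + 1)) : R :=
  ∑ l : Fin (d + 1) with l < r, ((d - (l : ℕ)).choose (d - r) : R) * u ^ ((r : ℕ) - l) * x l

theorem unipShift_congr (u : R) {x y : Fin (d + 1) → R} {r : Fin (d + 1)}
    (h : ∀ l < r, x l = y l) : unipShift u x r = unipShift u y r :=
  Finset.sum_congr rfl fun l hl => by rw [h l (Finset.mem_filter.1 hl).2]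

/-- The coefficient of `v₁ ^ (d - r) v₂ ^ r` in the transform of the monomial `v₁ ^ (d - l) v₂ ^ l` under
`v ↦ (v₁ s + v₂ w, v₂ s₂)`. For `r < l` it is zero, in agreement with the binomial coefficient on
the right, whose exponent `r - l` is then truncated. -/
theorem coeff_binomial_form (s w s₂ : R) {l r : ℕ} (hl : l ≤ d) (hr : r ≤ d) :
    MvPolynomial.coeff (Finsupp.single 0 (d - r) + Finsupp.single 1 r)
      ((MvPolynomial.X 0 * MvPolynomial.C s + MvPolynomial.X 1 * MvPolynomial.C w) ^ (d - l) *
        (MvPolynomial.X 1 * MvPolynomial.C s₂ : MvPolynomial (Fin 2) R) ^ l) =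
      ((d - l).choose (d - r) : R) * s ^ (d - r) * w ^ (r - l) * s₂ ^ l := by
  rw [add_pow, Finset.sum_mul, MvPolynomial.coeff_sum]
  have hterm : ∀ k ∈ Finset.range (d - l + 1),
      (MvPolynomial.X 0 * MvPolynomial.C s) ^ k *
        (MvPolynomial.X 1 * MvPolynomial.C w) ^ (d - l - k) * ((d - l).choose k : MvPolynomial (Fin 2) R) *
        (MvPolynomial.X 1 * MvPolynomial.C s₂ : MvPolynomial (Fin 2) R) ^ l =
      MvPolynomial.monomial (Finsupp.single 0 k + Finsupp.single 1 (d - k))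
        (((d - l).choose k : R) * s ^ k * w ^ (d - l - k) * s₂ ^ l) := by
    intro k hk
    have hk' : k ≤ d - l := Nat.lt_succ_iff.1 (Finset.mem_range.1 hk)
    rw [MvPolynomial.monomial_eq, ← map_natCast (MvPolynomial.C (σ := Fin 2) (R := R))]
    rw [Finsupp.prod_add_index' (by simp) (by intros; rw [pow_add]),
      Finsupp.prod_single_index (by simp), Finsupp.prod_single_index (by simp),
      show d - k = (d - l - k) + l by omega, pow_add]
    simp only [mul_pow, map_mul, map_pow]
    ring
  rw [Finset.sum_congr rfl fun k hk => by rw [hterm k hk]]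
  simp only [MvPolynomial.coeff_monomial]
  have hiff : ∀ k ∈ Finset.range (d - l + 1),
      ((Finsupp.single 0 k + Finsupp.single 1 (d - k) : Fin 2 →₀ ℕ) =
        Finsupp.single 0 (d - r) + Finsupp.single 1 r) ↔ k = d - r := by
    intro k hk
    constructor
    · intro h
      simpa using DFunLike.congr_fun h 0
    · rintro rfl
      rw [Nat.sub_sub_self hr]
  rw [Finset.sum_congr rfl fun k hk => by rw [if_congr (hiff k hk) rfl rfl]]
  rw [Finset.sum_ite_eq']
  split_ifs with h
  · have : d - l - (d - r) = r - l := by have := Finset.mem_range.1 h; omega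
    rw [this]
  · rw [Nat.choose_eq_zero_of_lt (by simp only [Finset.mem_range] at h; omega)]
    simp

theorem formAct_diagonal_mul_lowerUnip (s₁ s₂ u : R) (x : Fin (d + 1) → R) (r : Fin (d + 1)) :
    formAct (Matrix.diagonal ![s₁, s₂] * lowerUnip u) x r =
      s₁ ^ (d - (r : ℕ)) * s₂ ^ (r : ℕ) * (x r + unipShift u x r) := by
  have hr : (r : ℕ) ≤ d := Nat.lt_succ_iff.1 r.2
  have hm : Matrix.diagonal ![s₁, s₂] * lowerUnip u = !![s₁, 0; s₂ * u, s₂] := by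
    ext a c
    fin_cases a <;> fin_cases c <;> simp [lowerUnip, Matrix.diagonal_mul]
  have hform : formAct (Matrix.diagonal ![s₁, s₂] * lowerUnip u) x r = ∑ l : Fin (d + 1),
      x l * (((d - (l : ℕ)).choose (d - r) : R) * s₁ ^ (d - (r : ℕ)) * (s₂ * u) ^ ((r : ℕ) - l) *
        s₂ ^ (l : ℕ)) := by
    rw [hm, formAct, binaryForm, map_sum, MvPolynomial.coeff_sum]
    refine Finset.sum_congr rfl fun l _ => ?_
    rw [← coeff_binomial_form s₁ (s₂ * u) s₂ (Nat.lt_succ_iff.1 l.2) hr,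
      ← MvPolynomial.coeff_C_mul]
    congr 1
    simp [Fin.sum_univ_two, mul_assoc]
  rw [hform, ← Finset.sum_filter_add_sum_filter_not _ (fun l => l < r), unipShift, mul_add, add_comm]
  congr 1
  · rw [Finset.sum_eq_single_of_mem r (by simp)]
    · simp; ring
    · intro l hl hlr
      have h1 : r < l := lt_of_le_of_ne (not_lt.1 (Finset.mem_filter.1 hl).2) (Ne.symm hlr)
      have h2 : (r : ℕ) < l := h1
      rw [Nat.choose_eq_zero_of_lt (by have := l.2; omega)]
      simp
  · rw [Finset.mul_sum]
    refine Finset.sum_congr rfl fun l hl => ?_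
    have h2 : (l : ℕ) < r := (Finset.mem_filter.1 hl).2
    obtain ⟨e, he⟩ := Nat.exists_eq_add_of_lt h2
    rw [show (r : ℕ) - l = e + 1 by omega, show (r : ℕ) = e + 1 + l by omega]
    ring

end Forms

variable {K : Type*} [Field K] [NumberField K]

/-- The absolute value of a Schwartz–Bruhat function is dominated by a rapidly decaying function of
the infinite part, and its support has bounded denominators. -/
theorem exists_rapidProfile_of_mem_schwartzBruhat {n : ℕ} {Ψ : (Fin n → Adele K) → ℂ}
    (hΨ : Ψ ∈ SchwartzBruhat K n) :
    ∃ D : ℕ, D ≠ 0 ∧ ∃ φ, IsRapidProfile φ ∧ ∀ a, ‖Ψ a‖ ≤ φ ‖fun m => archPart K (a m)‖ ∧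
      (Ψ a ≠ 0 → ∀ m, finPart K (a m) ∈ denomDvd K D) := by
  induction hΨ using Submodule.span_induction with
  | mem F hF =>
    obtain ⟨f, h, hloc, hcomp, hF⟩ := hF
    obtain ⟨φ, hφ, hf⟩ := SchwartzMap.exists_rapidProfile f
    obtain ⟨B, hB⟩ := hcomp.exists_bound_of_continuous hloc.continuous
    have hproj : ∀ m : Fin n, ∃ D : ℕ, D ≠ 0 ∧ (fun y => y m) '' tsupport h ⊆ denomDvd K D :=
      fun m => IsCompact.exists_subset_denomDvd (hcomp.isCompact.image (continuous_apply m))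
    choose D hD0 hD using hproj
    refine ⟨∏ m, D m, Finset.prod_ne_zero_iff.2 fun m _ => hD0 m, fun r => |B| * φ r,
      hφ.const_mul (abs_nonneg B), fun a => ⟨?_, fun hne m => ?_⟩⟩
    · rw [hF, norm_mul, mul_comm]
      exact mul_le_mul ((hB _).trans (le_abs_self B)) (hf _) (norm_nonneg _) (abs_nonneg B)
    · rw [hF] at hne
      exact denomDvd_mono (Finset.dvd_prod_of_mem D (Finset.mem_univ m))
        (hD m ⟨_, subset_tsupport h (right_ne_zero_of_mul hne), rfl⟩)
  | zero =>
    refine ⟨1, one_ne_zero, fun _ => 0, ⟨antitone_const, fun _ => le_rfl, fun N => ⟨0, by simp⟩⟩,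
      fun a => ⟨by simp, fun h => absurd rfl h⟩⟩
  | add F G _ _ hF hG =>
    obtain ⟨D₁, hD₁, φ₁, h₁, hF⟩ := hF
    obtain ⟨D₂, hD₂, φ₂, h₂, hG⟩ := hG
    refine ⟨D₁ * D₂, mul_ne_zero hD₁ hD₂, _, h₁.add h₂, fun a => ⟨?_, fun hne m => ?_⟩⟩
    · exact (norm_add_le _ _).trans (add_le_add (hF a).1 (hG a).1)
    · by_cases hz : F a = 0
      · have : G a ≠ 0 := fun h => hne (by rw [Pi.add_apply, hz, h, add_zero])
        exact denomDvd_mono (dvd_mul_left _ _) ((hG a).2 this m)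
      · exact denomDvd_mono (dvd_mul_right _ _) ((hF a).2 hz m)
  | smul c F _ hF =>
    obtain ⟨D, hD, φ, h, hF⟩ := hF
    refine ⟨D, hD, _, h.const_mul (norm_nonneg c), fun a => ⟨?_, fun hne => (hF a).2 ?_⟩⟩
    · rw [Pi.smul_apply, _root_.norm_smul]
      exact mul_le_mul_of_nonneg_left (hF a).1 (norm_nonneg c)
    · exact fun h0 => hne (by rw [Pi.smul_apply, h0, smul_zero])

/-- A Schwartz function of the infinite part, cut off to denominators dividing `D`, is
Schwartz–Bruhat. -/
theorem ite_denomDvd_mem_schwartzBruhat {n : ℕ} {D : ℕ} (hD : D ≠ 0)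
    (g : SchwartzMap (Fin n → mixedSpace K) ℂ) :
    (fun a : Fin n → Adele K => if ∀ m, finPart K (a m) ∈ denomDvd K D then
      g fun m => archPart K (a m) else 0) ∈ SchwartzBruhat K n := by
  have hU : IsClopen (Set.univ.pi fun _ : Fin n => denomDvd K D) :=
    ⟨isClosed_set_pi fun _ _ => isClosed_denomDvd D,
      isOpen_set_pi Set.finite_univ fun _ _ => isOpen_denomDvd D⟩
  refine Submodule.subset_span ⟨g, LocallyConstant.charFn ℂ hU, LocallyConstant.isLocallyConstant _,
    HasCompactSupport.intro (isCompact_univ_pi fun _ => isCompact_denomDvd hD) fun y hy => ?_,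
    fun a => ?_⟩
  · rw [LocallyConstant.coe_charFn, Set.indicator_of_notMem hy]
  · rw [LocallyConstant.coe_charFn]
    beta_reduce
    by_cases h : ∀ m, finPart K (a m) ∈ denomDvd K D
    · have hm : (fun m => (a m).2) ∈ Set.univ.pi fun _ : Fin n => denomDvd K D := fun m _ => h m
      rw [if_pos h, Set.indicator_of_mem hm, Pi.one_apply, mul_one]
      rfl
    · have hm : (fun m => (a m).2) ∉ Set.univ.pi fun _ : Fin n => denomDvd K D :=
        fun hm => h fun m => hm m (Set.mem_univ m)
      rw [if_neg h, Set.indicator_of_notMem hm, mul_zero]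

/-- Multiplication by the elements of a compact set of ideles distorts denominators and infinite
norms by bounded amounts. -/
theorem exists_scaling_of_isCompact {T : Set (Adele K)ˣ} (hT : IsCompact T) :
    ∃ E : ℕ, E ≠ 0 ∧ ∃ κ : ℝ, 0 < κ ∧ ∀ τ ∈ T, ∀ a : Adele K,
      (∀ D, finPart K (τ * a) ∈ denomDvd K D → finPart K a ∈ denomDvd K (E * D)) ∧
      κ * ‖archPart K a‖ ≤ ‖archPart K (τ * a)‖ := by
  have hinv : Continuous fun τ : (Adele K)ˣ => ((τ⁻¹ : (Adele K)ˣ) : Adele K) :=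
    Units.continuous_val.comp continuous_inv
  obtain ⟨E, hE, hsub⟩ := IsCompact.exists_subset_denomDvd
    (hT.image (continuous_finPart.comp hinv))
  obtain ⟨B, hB⟩ := hT.exists_bound_of_continuousOn
    (continuous_archPart.comp hinv).continuousOn
  refine ⟨E, hE, (1 + |B|)⁻¹, by positivity, fun τ hτ a => ?_⟩
  have ha : a = ((τ⁻¹ : (Adele K)ˣ) : Adele K) * (τ * a) := by rw [Units.inv_mul_cancel_left]
  refine ⟨fun D h => ?_, ?_⟩
  · rw [ha, map_mul]
    exact mul_mem_denomDvd (hsub ⟨τ, hτ, rfl⟩) h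
  · rw [inv_mul_le_iff₀ (by positivity)]
    conv_lhs => rw [ha, map_mul]
    refine (norm_mul_le _ _).trans ?_
    gcongr
    have := hB τ hτ
    simp only [Function.comp_apply] at this
    linarith [le_abs_self B]

end

/-! ### The coordinates of `b̃ x` -/

section

open scoped Classical
open mixedEmbedding

variable {K : Type*} [Field K] [NumberField K]

namespace BorelElt

/-- The scale `λ μ ^ (d - 2 r)` of the `r`-th coordinate of forms of degree `d = 2 d₁`. -/
def scale (b : BorelElt K) (d₁ r : ℕ) : ℝ := b.lam * b.mu ^ (2 * (d₁ : ℤ) - 2 * (r : ℤ))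

theorem scale_pos (b : BorelElt K) (d₁ r : ℕ) : 0 < b.scale d₁ r :=
  mul_pos b.lam_pos (zpow_pos b.mu_pos _)

/-- The part `t t₁ ^ (d - r) t₂ ^ r` of absolute value one in the weight of the `r`-th coordinate. -/
def twist (b : BorelElt K) (d r : ℕ) : (Adele K)ˣ := b.t * b.t₁ ^ (d - r) * b.t₂ ^ r

/-- Separation of the weight into a part from a compact set and a positive real scale. -/
theorem lamIdele_mul_weight (b : BorelElt K) {d₁ r : ℕ} (hr : r ≤ 2 * d₁) :
    b.lamIdele * b.weight (2 * d₁) r =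
      b.twist (2 * d₁) r * realIdele K (b.scale d₁ r) (b.scale_pos d₁ r) := by
  have h : realIdele K (b.scale d₁ r) (b.scale_pos d₁ r) =
      b.lamIdele * b.muIdele ^ (2 * (d₁ : ℤ) - 2 * (r : ℤ)) := by
    rw [lamIdele, muIdele, realIdele_zpow, realIdele_mul]
    rfl
  have h2 : b.muIdele ^ (2 * (d₁ : ℤ) - 2 * (r : ℤ)) = b.muIdele ^ (2 * d₁ - r) * (b.muIdele⁻¹) ^ r := by
    rw [← zpow_natCast, inv_pow, ← zpow_natCast, ← zpow_neg, ← zpow_add, Nat.cast_sub hr]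
    congr 1
    push_cast
    ring
  rw [h, h2, weight, twist, mul_pow, mul_pow]
  ac_rfl

/-- The `r`-th coordinate of `b̃ x`, without its twist. -/
def normCoord (b : BorelElt K) {d₁ : ℕ} (x : Fin (2 * d₁ + 1) → K) (r : Fin (2 * d₁ + 1)) :
    Adele K :=
  ((realIdele K (b.scale d₁ r) (b.scale_pos d₁ r) : (Adele K)ˣ) : Adele K) *
    (algebraMap K (Adele K) (x r) + unipShift b.u (toAdelic x) r)

theorem act_toAdelic (b : BorelElt K) {d₁ : ℕ} (x : Fin (2 * d₁ + 1) → K) (r : Fin (2 * d₁ + 1)) :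
    b.act (toAdelic x) r = (b.twist (2 * d₁) r : Adele K) * b.normCoord x r := by
  rw [act, matrix, formAct_diagonal_mul_lowerUnip, normCoord,
    ← mul_assoc (b.twist (2 * d₁) r : Adele K), ← Units.val_mul (b.twist _ _),
    ← b.lamIdele_mul_weight (Nat.lt_succ_iff.1 r.2), weight]
  simp only [Units.val_mul, Units.val_pow_eq_pow_val, toAdelic]
  ring

/-- The last argument `λ̲⁻¹ γ_j(t⁰)⁻¹ x_j` of the theta series, without its twist. -/
def normDual (b : BorelElt K) (d₁ j : ℕ) (x : K) : Adele K :=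
  ((realIdele K (b.scale d₁ j)⁻¹ (inv_pos.2 (b.scale_pos d₁ j)) : (Adele K)ˣ) : Adele K) *
    algebraMap K (Adele K) x

theorem dual_eq (b : BorelElt K) {d₁ j : ℕ} (hj : j ≤ 2 * d₁) (x : Kˣ) :
    ((b.lamIdele⁻¹ * (b.weight (2 * d₁) j)⁻¹ * principalIdele x : (Adele K)ˣ) : Adele K) =
      ((b.twist (2 * d₁) j)⁻¹ : (Adele K)ˣ) * b.normDual d₁ j x := by
  rw [← mul_inv, b.lamIdele_mul_weight hj, mul_inv, realIdele_inv, normDual, ← mul_assoc]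
  rfl

end BorelElt

/-- The twists and their inverses stay in a compact set of ideles. -/
theorem exists_isCompact_twist_mem {C : Set (Adele K)ˣ} (hC : IsCompact C) (d : ℕ) :
    ∃ T : Set (Adele K)ˣ, IsCompact T ∧ ∀ b : BorelElt K, b.t ∈ C → b.t₁ ∈ C → b.t₂ ∈ C →
      ∀ r ≤ d, b.twist d r ∈ T ∧ (b.twist d r)⁻¹ ∈ T := by
  let F : ℕ → (Adele K)ˣ × (Adele K)ˣ × (Adele K)ˣ → (Adele K)ˣ :=
    fun r p => p.1 * p.2.1 ^ (d - r) * p.2.2 ^ r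
  have hF : ∀ r, Continuous (F r) := fun r => by fun_prop
  have hCCC := hC.prod (hC.prod hC)
  refine ⟨⋃ r ∈ Finset.range (d + 1), (F r '' (C ×ˢ C ×ˢ C) ∪
    (fun p => (F r p)⁻¹) '' (C ×ˢ C ×ˢ C)), ?_, fun b h h₁ h₂ r hr => ⟨?_, ?_⟩⟩
  · exact (Finset.range (d + 1)).isCompact_biUnion fun r _ =>
      (hCCC.image (hF r)).union (hCCC.image (hF r).inv)
  · exact Set.mem_biUnion (Finset.mem_coe.2 (Finset.mem_range.2 (Nat.lt_succ_of_le hr)))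
      (Or.inl ⟨(b.t, b.t₁, b.t₂), ⟨h, h₁, h₂⟩, rfl⟩)
  · exact Set.mem_biUnion (Finset.mem_coe.2 (Finset.mem_range.2 (Nat.lt_succ_of_le hr)))
      (Or.inr ⟨(b.t, b.t₁, b.t₂), ⟨h, h₁, h₂⟩, rfl⟩)

/-- For a form in `stForms`, the coordinates of `n(u) x` before position `i` only involve
`x_{d₁}`. -/
theorem unipShift_stForms {d₁ : ℕ} {i j : Fin (2 * d₁ + 1)} (u : Adele K)
    {x : Fin (2 * d₁ + 1) → K} (hx : x ∈ stForms K d₁ i j) {r : Fin (2 * d₁ + 1)}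
    (hr : d₁ < (r : ℕ)) (hri : r ≤ i) :
    unipShift u (toAdelic x) r = (d₁.choose (2 * d₁ - r) : Adele K) * u ^ ((r : ℕ) - d₁) *
      algebraMap K (Adele K) (x ⟨d₁, by omega⟩) := by
  rw [unipShift, Finset.sum_eq_single_of_mem (⟨d₁, by omega⟩ : Fin (2 * d₁ + 1))]
  · simp only [toAdelic]
    rw [show 2 * d₁ - d₁ = d₁ by omega]
  · exact Finset.mem_filter.2 ⟨Finset.mem_univ _, hr⟩
  · intro l hl hne
    have hlr : l < r := (Finset.mem_filter.1 hl).2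
    have : x l = 0 := by
      by_contra h0
      rcases hx.2.2 l h0 with h | h
      · exact hne (Fin.ext h)
      · exact absurd (lt_of_lt_of_le hlr hri) (not_lt.2 h.1)
    rw [toAdelic, this, map_zero, mul_zero]

theorem unipShift_stForms_base {d₁ : ℕ} {i j : Fin (2 * d₁ + 1)} (hi : d₁ < (i : ℕ)) (u : Adele K)
    {x : Fin (2 * d₁ + 1) → K} (hx : x ∈ stForms K d₁ i j) :
    unipShift u (toAdelic x) ⟨d₁, by omega⟩ = 0 := by
  refine Finset.sum_eq_zero fun l hl => ?_
  have hl' : (l : ℕ) < d₁ := (Finset.mem_filter.1 hl).2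
  have : x l = 0 := by
    by_contra h0
    rcases hx.2.2 l h0 with h | h
    · omega
    · have : (i : ℕ) ≤ l := h.1
      omega
  rw [toAdelic, this, map_zero, mul_zero]

theorem majorantArg_zero (b : BorelElt K) (x : Kˣ) :
    majorantArg b x 0 = ((realIdele K b.lam b.lam_pos : (Adele K)ˣ) : Adele K) *
      (algebraMap K (Adele K) x + 0) := by
  rw [add_zero]; rfl

/-- The first two coordinates of `b̃ x` that can be nonzero are, up to twists and a binomial
coefficient, the two components of `majorantArg`. -/
theorem normCoord_eq_majorantArg {d₁ : ℕ} {i j : Fin (2 * d₁ + 1)} (hi : d₁ + 2 ≤ (i : ℕ))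
    (b : BorelElt K) {x : Fin (2 * d₁ + 1) → K} (hx : x ∈ stForms K d₁ i j) (x₀ : Kˣ)
    (hx₀ : x ⟨d₁, by omega⟩ = x₀) :
    b.normCoord x ⟨d₁, by omega⟩ = majorantArg b x₀ 0 ∧
    b.normCoord x ⟨d₁ + 1, by omega⟩ = (d₁ : Adele K) * majorantArg b x₀ 1 := by
  constructor
  · rw [BorelElt.normCoord, unipShift_stForms_base (by omega) b.u hx, hx₀, majorantArg_zero]
    congr 3
    simp [BorelElt.scale]
  · have h0 : x ⟨d₁ + 1, by omega⟩ = 0 := by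
      by_contra h0
      rcases hx.2.2 _ h0 with h | h
      · simp at h
      · have : (i : ℕ) ≤ d₁ + 1 := h.1
        omega
    have hs : realIdele K (b.scale d₁ (d₁ + 1)) (b.scale_pos d₁ (d₁ + 1)) =
        b.lamIdele * b.muIdele ^ (-2 : ℤ) := by
      have : b.scale d₁ (d₁ + 1) = b.lam * b.mu ^ (-2 : ℤ) := by
        rw [BorelElt.scale]
        congr 2
        push_cast
        ring
      rw [BorelElt.lamIdele, BorelElt.muIdele, realIdele_zpow, realIdele_mul]
      simp only [this]
    have hle : (⟨d₁ + 1, by omega⟩ : Fin (2 * d₁ + 1)) ≤ i := by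
      rw [Fin.le_def]; simp only; omega
    rw [BorelElt.normCoord, h0, map_zero, zero_add,
      unipShift_stForms b.u hx (Nat.lt_succ_self d₁) hle]
    change ((realIdele K (b.scale d₁ (d₁ + 1)) (b.scale_pos d₁ (d₁ + 1)) : (Adele K)ˣ) : Adele K) *
      _ = _ * (((b.lamIdele * b.muIdele ^ (-2 : ℤ) * principalIdele x₀ : (Adele K)ˣ) : Adele K) *
        b.u)
    rw [hs, hx₀, Units.val_mul (b.lamIdele * b.muIdele ^ (-2 : ℤ))]
    have hch : d₁.choose (2 * d₁ - (d₁ + 1)) = d₁ := by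
      obtain ⟨e, rfl⟩ : ∃ e, d₁ = e + 1 := ⟨d₁ - 1, by omega⟩
      rw [show 2 * (e + 1) - (e + 1 + 1) = e by omega, Nat.choose_succ_self_right]
    simp only [hch, Nat.add_sub_cancel_left, pow_one]
    change _ = _ * (_ * algebraMap K (Adele K) (x₀ : K) * b.u)
    ring

end

/-! ### The termwise estimate and the relation that eliminates `u` -/

section

open scoped Classical ENNReal
open mixedEmbedding

variable {K : Type*} [Field K] [NumberField K]

theorem decayWeight_of_mem {D M : ℕ} {a : Adele K} (h : finPart K a ∈ denomDvd K D) :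
    decayWeight D M a = ((1 + ‖archPart K a‖) ^ M)⁻¹ := if_pos h

/-- The Schwartz–Bruhat function `Ψ'` of the theorem, with a pointwise estimate of the terms of the
theta series: on the support the denominators of all coordinates are bounded, and a common bound `R`
for their infinite parts enters with an arbitrary negative power. The profile of `Ψ` is split into
two square roots, one of which yields `Ψ'` and the other the powers of `R`. -/
theorem exists_termwise_majorant {C : Set (Adele K)ˣ} (hC : IsCompact C) {d₁ : ℕ}
    {i j : Fin (2 * d₁ + 1)} (hi : d₁ + 2 ≤ (i : ℕ)) (hij : i < j)
    {Ψ : (Fin ((j : ℕ) - d₁ + 1) → Adele K) → ℂ} (hΨ : Ψ ∈ SchwartzBruhat K ((j : ℕ) - d₁ + 1)) :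
    ∃ D : ℕ, D ≠ 0 ∧ ∃ Ψ' : (Fin 2 → Adele K) → ℝ,
      (fun y => (Ψ' y : ℂ)) ∈ SchwartzBruhat K 2 ∧ (∀ y, 0 ≤ Ψ' y) ∧
      (∀ N : ℕ, ∃ c : ℝ, 0 ≤ c ∧ ∀ y, Ψ' y ≤ c * decayWeight D N (y 0)) ∧
      ∀ N : ℕ, ∃ c : ℝ, 0 ≤ c ∧ ∀ b : BorelElt K, b.t ∈ C → b.t₁ ∈ C → b.t₂ ∈ C →
        ∀ x ∈ stForms K d₁ i j, ∀ xj x₀ : Kˣ, x ⟨d₁, by omega⟩ = x₀ → Ψ (thetaArg j b x xj) ≠ 0 →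
          ∃ R : ℝ, 1 ≤ R ∧
            (∀ r : Fin (2 * d₁ + 1), d₁ ≤ (r : ℕ) → r < j →
              finPart K (b.normCoord x r) ∈ denomDvd K D ∧
                1 + ‖archPart K (b.normCoord x r)‖ ≤ R) ∧
            (finPart K (b.normDual d₁ j xj) ∈ denomDvd K D ∧
                1 + ‖archPart K (b.normDual d₁ j xj)‖ ≤ R) ∧
            ‖Ψ (thetaArg j b x xj)‖ ≤ c * (R ^ N)⁻¹ * Ψ' (majorantArg b x₀) := by
  obtain ⟨D₀, hD₀, φ, hφ, hΨφ⟩ := exists_rapidProfile_of_mem_schwartzBruhat hΨ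
  obtain ⟨T, hT, hTmem⟩ := exists_isCompact_twist_mem hC (2 * d₁)
  obtain ⟨E, hE, κ, hκ, hscale⟩ := exists_scaling_of_isCompact hT
  have hj2 : (j : ℕ) ≤ 2 * d₁ := Nat.lt_succ_iff.1 j.2
  have hij' : (i : ℕ) < j := hij
  have hd₁ : d₁ ≠ 0 := by omega
  obtain ⟨g, g₀, hg, hφg⟩ := (hφ.sqrt.comp_mul hκ).exists_schwartz
    (E := Fin 2 → mixedSpace K)
  -- the factor `d₁` absorbs the binomial coefficient in the coordinate `d₁ + 1`
  set D := E * D₀ * d₁ with hDdef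
  have hD : D ≠ 0 := mul_ne_zero (mul_ne_zero hE hD₀) hd₁
  have hg₀ : ∀ x, 0 ≤ g₀ x := fun x => (Real.sqrt_nonneg _).trans (hφg x)
  refine ⟨D, hD, fun y => if ∀ m, finPart K (y m) ∈ denomDvd K D then
    g₀ fun m => archPart K (y m) else 0, ?_, fun y => ?_, fun N => ?_, fun N => ?_⟩
  · convert ite_denomDvd_mem_schwartzBruhat hD g using 2 with y
    beta_reduce
    split_ifs
    · exact (hg _).symm
    · simp
  · beta_reduce
    split_ifs
    exacts [hg₀ _, le_rfl]
  · obtain ⟨φ', hφ', hgφ'⟩ := SchwartzMap.exists_rapidProfile g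
    obtain ⟨c, hc⟩ := hφ'.decay N
    have hc0 : 0 ≤ c := le_trans (mul_nonneg (by positivity) (hφ'.nonneg 0)) (hc 0 le_rfl)
    refine ⟨c, hc0, fun y => ?_⟩
    beta_reduce
    split_ifs with h
    · rw [decayWeight_of_mem (h 0), ← div_eq_mul_inv, le_div_iff₀ (by positivity), mul_comm]
      set v : Fin 2 → mixedSpace K := fun m => archPart K (y m) with hv
      have h1 : ‖archPart K (y 0)‖ ≤ ‖v‖ := norm_le_pi_norm v 0
      refine le_trans ?_ (hc ‖v‖ (norm_nonneg _))
      have h2 : g₀ v ≤ φ' ‖v‖ := by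
        have := hgφ' v
        rwa [hg, Complex.norm_real, Real.norm_of_nonneg (hg₀ v)] at this
      have := hg₀ v
      gcongr
    · exact mul_nonneg hc0 (decayWeight_nonneg _ _ _)
  · obtain ⟨c, hc⟩ := hφ.sqrt.decay N
    have hc0 : 0 ≤ c := le_trans (mul_nonneg (by positivity) (Real.sqrt_nonneg _)) (hc 0 le_rfl)
    refine ⟨(1 + κ⁻¹) ^ N * c, by positivity, fun b hb hb₁ hb₂ x hx xj x₀ hx₀ hne => ?_⟩
    set v : Fin ((j : ℕ) - d₁ + 1) → mixedSpace K := fun m => archPart K (thetaArg j b x xj m)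
      with hv
    have hsupp := (hΨφ _).2 hne
    have hcoord : ∀ r : Fin (2 * d₁ + 1), d₁ ≤ (r : ℕ) → r < j →
        finPart K (b.normCoord x r) ∈ denomDvd K (E * D₀) ∧
          κ * ‖archPart K (b.normCoord x r)‖ ≤ ‖v‖ := by
      intro r hr hrj
      have hrj' : (r : ℕ) < j := hrj
      have heq : thetaArg j b x xj (Fin.castSucc ⟨(r : ℕ) - d₁, by omega⟩) =
          (b.twist (2 * d₁) r : Adele K) * b.normCoord x r := by
        rw [thetaArg, Fin.snoc_castSucc, ← BorelElt.act_toAdelic]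
        congr 1
        exact Fin.ext (by simp only; omega)
      have h := hscale _ (hTmem b hb hb₁ hb₂ r (by omega)).1 (b.normCoord x r)
      rw [← heq] at h
      exact ⟨h.1 _ (hsupp _), h.2.trans (norm_le_pi_norm v _)⟩
    have hdual : finPart K (b.normDual d₁ j xj) ∈ denomDvd K (E * D₀) ∧
          κ * ‖archPart K (b.normDual d₁ j xj)‖ ≤ ‖v‖ := by
      have heq : thetaArg j b x xj (Fin.last _) =
          ((b.twist (2 * d₁) j)⁻¹ : (Adele K)ˣ) * b.normDual d₁ j xj := by
        rw [thetaArg, Fin.snoc_last, BorelElt.dual_eq b hj2]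
      have h := hscale _ (hTmem b hb hb₁ hb₂ j hj2).2 (b.normDual d₁ j xj)
      rw [← heq] at h
      exact ⟨h.1 _ (hsupp _), h.2.trans (norm_le_pi_norm v _)⟩
    have hR : ∀ y : ℝ, κ * y ≤ ‖v‖ → 1 + y ≤ 1 + κ⁻¹ * ‖v‖ := by
      intro y hy
      have : y ≤ κ⁻¹ * ‖v‖ := by rwa [le_inv_mul_iff₀ hκ]
      linarith
    have hDD : denomDvd K (E * D₀) ⊆ denomDvd K D := denomDvd_mono (dvd_mul_right _ _)
    refine ⟨1 + κ⁻¹ * ‖v‖, le_add_of_nonneg_right (by positivity), fun r hr hrj =>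
      ⟨hDD (hcoord r hr hrj).1, hR _ (hcoord r hr hrj).2⟩, ⟨hDD hdual.1, hR _ hdual.2⟩, ?_⟩
    obtain ⟨h0, h1⟩ := normCoord_eq_majorantArg hi b hx x₀ hx₀
    have hc₀ := hcoord ⟨d₁, by omega⟩ le_rfl (by rw [Fin.lt_def]; simp only; omega)
    have hc₁ := hcoord ⟨d₁ + 1, by omega⟩ (by simp) (by rw [Fin.lt_def]; simp only; omega)
    rw [h0] at hc₀
    rw [h1, map_mul, map_mul, map_natCast, map_natCast] at hc₁
    have hin : ∀ m, finPart K (majorantArg b x₀ m) ∈ denomDvd K D := by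
      intro m
      fin_cases m
      · exact hDD hc₀.1
      · exact mem_denomDvd_of_natCast_mul_mem hc₁.1
    beta_reduce
    rw [if_pos hin]
    have hnorm : κ * ‖fun m => archPart K (majorantArg b x₀ m)‖ ≤ ‖v‖ := by
      rw [← le_div_iff₀' hκ]
      refine (pi_norm_le_iff_of_nonneg (by positivity)).2 fun m => ?_
      rw [le_div_iff₀' hκ]
      fin_cases m
      · exact hc₀.2
      · refine le_trans ?_ hc₁.2
        rw [norm_natCast_mul]
        gcongr
        exact le_mul_of_one_le_left (norm_nonneg _) (Nat.one_le_cast.2 (Nat.pos_of_ne_zero hd₁))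
    have hA : √(φ ‖v‖) ≤ (1 + κ⁻¹) ^ N * c * ((1 + κ⁻¹ * ‖v‖) ^ N)⁻¹ := by
      rw [← div_eq_mul_inv, le_div_iff₀ (by positivity), mul_comm]
      calc (1 + κ⁻¹ * ‖v‖) ^ N * √(φ ‖v‖) ≤ ((1 + κ⁻¹) * (1 + ‖v‖)) ^ N * √(φ ‖v‖) := by
            gcongr
            nlinarith [norm_nonneg v, inv_pos.2 hκ]
        _ = (1 + κ⁻¹) ^ N * ((1 + ‖v‖) ^ N * √(φ ‖v‖)) := by rw [mul_pow]; ring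
        _ ≤ _ := by
            gcongr
            exact hc _ (norm_nonneg _)
    have hB : √(φ ‖v‖) ≤ g₀ fun m => archPart K (majorantArg b x₀ m) :=
      (hφ.sqrt.antitone hnorm).trans (hφg _)
    calc _ ≤ φ ‖v‖ := (hΨφ _).1
      _ = √(φ ‖v‖) * √(φ ‖v‖) := (Real.mul_self_sqrt (hφ.nonneg _)).symm
      _ ≤ _ := mul_le_mul hA hB (Real.sqrt_nonneg _) (by positivity)

/-- An idele `r̲ x` with `x ∈ Kˣ` whose finite part has bounded denominator and whose infinite part
is bounded has bounded `r`. -/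
theorem le_pow_of_norm_archPart_le {D : ℕ} (hD : D ≠ 0) {r : ℝ} (hr : 0 < r) {x : K} (hx : x ≠ 0)
    (hfin : finPart K (((realIdele K r hr : (Adele K)ˣ) : Adele K) * algebraMap K (Adele K) x) ∈
      denomDvd K D) {R : ℝ}
    (hR : ‖archPart K (((realIdele K r hr : (Adele K)ˣ) : Adele K) * algebraMap K (Adele K) x)‖ ≤ R) :
    r ≤ (D * R) ^ Module.finrank ℚ K := by
  rw [finPart_realIdele_mul, finPart_algebraMap] at hfin
  rw [norm_archPart_realIdele_mul, archPart_algebraMap] at hR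
  have h1 := one_le_mul_norm_mixedEmbedding hx hD hfin
  have hpos := Real.rpow_nonneg hr.le (1 / (Module.finrank ℚ K : ℝ))
  have h2 : r ^ (1 / (Module.finrank ℚ K : ℝ)) ≤ D * R := by
    calc r ^ (1 / (Module.finrank ℚ K : ℝ)) ≤
        r ^ (1 / (Module.finrank ℚ K : ℝ)) * (D * ‖mixedEmbedding K x‖) :=
          le_mul_of_one_le_right hpos h1
      _ = D * (r ^ (1 / (Module.finrank ℚ K : ℝ)) * ‖mixedEmbedding K x‖) := by ring
      _ ≤ _ := by gcongr
  have h3 := pow_le_pow_left₀ hpos h2 (Module.finrank ℚ K)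
  rwa [one_div, Real.rpow_inv_natCast_pow hr.le (Module.finrank_pos).ne'] at h3

/-- The relation between the coordinates `d₁`, `d₁ + 1`, `i - 1` and `i` of `b̃ x` that eliminates
`u`: with `X_r` denoting the coordinates, `c X_i X_{d₁} - c' X_{d₁+1} X_{i-1}` is the idele
`λ̲² μ̲ ^ (2 d₁ - 2 i)` times a nonzero element of `K`. -/
theorem normCoord_relation {d₁ : ℕ} {i j : Fin (2 * d₁ + 1)} (hi : d₁ + 2 ≤ (i : ℕ))
    (b : BorelElt K) {x : Fin (2 * d₁ + 1) → K} (hx : x ∈ stForms K d₁ i j) :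
    ((d₁.choose (2 * d₁ - (i - 1)) * d₁ : ℕ) : Adele K) *
        (b.normCoord x i * b.normCoord x ⟨d₁, by omega⟩) -
      (d₁.choose (2 * d₁ - i) : Adele K) *
        (b.normCoord x ⟨d₁ + 1, by omega⟩ * b.normCoord x ⟨(i : ℕ) - 1, by omega⟩) =
    ((realIdele K (b.lam * b.scale d₁ i) (mul_pos b.lam_pos (b.scale_pos d₁ i)) : (Adele K)ˣ) :
        Adele K) * algebraMap K (Adele K)
          (((d₁.choose (2 * d₁ - (i - 1)) * d₁ : ℕ) : K) * (x i * x ⟨d₁, by omega⟩)) := by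
  have hi2 := i.2
  have hz : ∀ r : Fin (2 * d₁ + 1), d₁ < (r : ℕ) → r < i → x r = 0 := by
    intro r hr hri
    by_contra h0
    rcases hx.2.2 r h0 with h | h
    · omega
    · exact absurd hri (not_lt.2 h.1)
  have hscale : ∀ r₁ r₂ : ℕ, r₁ + r₂ = i + d₁ →
      realIdele K (b.scale d₁ r₁) (b.scale_pos d₁ r₁) *
        realIdele K (b.scale d₁ r₂) (b.scale_pos d₁ r₂) =
      realIdele K (b.lam * b.scale d₁ i) (mul_pos b.lam_pos (b.scale_pos d₁ i)) := by
    intro r₁ r₂ h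
    rw [realIdele_mul]
    have : b.scale d₁ r₁ * b.scale d₁ r₂ = b.lam * b.scale d₁ i := by
      have hsum : (2 * (d₁ : ℤ) - 2 * (r₁ : ℤ)) + (2 * (d₁ : ℤ) - 2 * (r₂ : ℤ)) =
          2 * (d₁ : ℤ) - 2 * ((i : ℕ) : ℤ) := by omega
      rw [BorelElt.scale, BorelElt.scale, BorelElt.scale, ← hsum, zpow_add₀ b.mu_pos.ne']
      ring
    simp only [this]
  have e₁ := congrArg Units.val (hscale i d₁ rfl)
  have e₂ := congrArg Units.val (hscale (d₁ + 1) (i - 1) (by omega))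
  rw [Units.val_mul] at e₁ e₂
  have hlt₁ : (⟨d₁ + 1, by omega⟩ : Fin (2 * d₁ + 1)) < i := by
    rw [Fin.lt_def]; simp only; omega
  have hlt₂ : (⟨(i : ℕ) - 1, by omega⟩ : Fin (2 * d₁ + 1)) < i := by
    rw [Fin.lt_def]; simp only; omega
  have hch : d₁.choose (2 * d₁ - (d₁ + 1)) = d₁ := by
    obtain ⟨e, rfl⟩ : ∃ e, d₁ = e + 1 := ⟨d₁ - 1, by omega⟩
    rw [show 2 * (e + 1) - (e + 1 + 1) = e by omega, Nat.choose_succ_self_right]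
  simp only [BorelElt.normCoord]
  rw [unipShift_stForms_base (by omega) b.u hx,
    unipShift_stForms b.u hx (r := i) (by omega) le_rfl,
    unipShift_stForms b.u hx (r := ⟨d₁ + 1, by omega⟩) (by simp) hlt₁.le,
    unipShift_stForms b.u hx (r := ⟨(i : ℕ) - 1, by omega⟩) (by simp only; omega) hlt₂.le,
    hz ⟨d₁ + 1, by omega⟩ (by simp) hlt₁, hz ⟨(i : ℕ) - 1, by omega⟩ (by simp only; omega) hlt₂]
  simp only [hch, map_zero, zero_add, add_zero, map_mul, map_natCast, Nat.cast_mul,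
    Nat.add_sub_cancel_left, pow_one]
  rw [show (i : ℕ) - d₁ = (i - 1 - d₁) + 1 by omega, pow_succ]
  -- `e₃` says that the two products of scales agree, because `i + d₁ = (d₁ + 1) + (i - 1)`; this is what
  -- makes the terms with `u` cancel
  have e₃ := e₂.trans e₁.symm
  rw [← e₁]
  linear_combination (-(d₁ : Adele K) * (d₁.choose (2 * d₁ - (i - 1)) : Adele K) *
    (d₁.choose (2 * d₁ - i) : Adele K) * b.u * b.u ^ ((i : ℕ) - 1 - d₁) *
    algebraMap K (Adele K) (x ⟨d₁, by omega⟩) ^ 2) * e₃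

/-- The trade of smallness against decay: if `s λ` and `λ` are at most `Q` then `max 1 s⁻¹` is at most
a power of `Q` times `(λ s) ^ (-N)`. -/
theorem max_one_inv_le_rpow {s lam Q N : ℝ} (hs : 0 < s) (hl : 0 < lam)
    (h₁ : lam * s ≤ Q) (h₂ : lam ≤ Q) (hN : 1 ≤ N) :
    max 1 s⁻¹ ≤ Q ^ N * (lam * s) ^ (-N) := by
  have hls := mul_pos hl hs
  have hQ : 0 < Q := hl.trans_le h₂
  rw [Real.rpow_neg hls.le, ← div_eq_mul_inv, ← Real.div_rpow hQ.le hls.le]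
  have h1 : 1 ≤ Q / (lam * s) := (one_le_div hls).2 h₁
  refine max_le (Real.one_le_rpow h1 (by linarith)) ?_
  refine le_trans ?_ (Real.self_le_rpow_of_one_le h1 hN)
  rw [le_div_iff₀ hls, mul_comm lam, inv_mul_cancel_left₀ hs.ne']
  exact h₂

end

/-! ### Bounds for the scales, and forms with prescribed coordinates -/

section

open scoped Classical ENNReal
open mixedEmbedding

variable {K : Type*} [Field K] [NumberField K]

/-- On the support of the theta series, `λ`, `λ² μ ^ (2 d₁ - 2 i)` and `λ⁻¹ μ ^ (2 j - 2 d₁)` are bounded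
polynomially in a bound `R` for the infinite parts of the coordinates. -/
theorem exists_scale_le {D : ℕ} (hD : D ≠ 0) {d₁ : ℕ}
    {i j : Fin (2 * d₁ + 1)} (hi : d₁ + 2 ≤ (i : ℕ)) (hij : i < j) :
    ∃ A : ℝ, 1 ≤ A ∧ ∀ (b : BorelElt K), ∀ x ∈ stForms K d₁ i j, ∀ (xj : Kˣ) (R : ℝ), 1 ≤ R →
      (∀ r : Fin (2 * d₁ + 1), d₁ ≤ (r : ℕ) → r < j →
        finPart K (b.normCoord x r) ∈ denomDvd K D ∧ 1 + ‖archPart K (b.normCoord x r)‖ ≤ R) →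
      (finPart K (b.normDual d₁ j xj) ∈ denomDvd K D ∧
        1 + ‖archPart K (b.normDual d₁ j xj)‖ ≤ R) →
      b.lam * b.scale d₁ i ≤ (A * R ^ 2) ^ Module.finrank ℚ K ∧
      b.lam ≤ (A * R ^ 2) ^ Module.finrank ℚ K ∧
      (b.scale d₁ j)⁻¹ ≤ (A * R ^ 2) ^ Module.finrank ℚ K := by
  have hij' : (i : ℕ) < j := hij
  have hi2 := i.2
  set c₁ : ℕ := d₁.choose (2 * d₁ - (i - 1)) * d₁ with hc₁
  set c₂ : ℕ := d₁.choose (2 * d₁ - i) with hc₂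
  have hc₁0 : c₁ ≠ 0 := mul_ne_zero (Nat.choose_pos (by omega)).ne' (by omega)
  have hD1 : (1 : ℝ) ≤ D := Nat.one_le_cast.2 (Nat.pos_of_ne_zero hD)
  -- the first summand serves the relation, whose two products have denominator `D * D`; the second
  -- serves `λ` and `x_j`
  refine ⟨(D * D : ℕ) * (c₁ + c₂) + D, ?_, fun b x hx xj R hR hcoord hdual => ?_⟩
  · have : (0 : ℝ) ≤ (D * D : ℕ) * (c₁ + c₂) := by positivity
    linarith
  have hDR : (D : ℝ) * R ≤ ((D * D : ℕ) * (c₁ + c₂) + D) * R ^ 2 := by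
    have h1 : (0 : ℝ) ≤ (D * D : ℕ) * (c₁ + c₂) * R ^ 2 := by positivity
    have h2 : (D : ℝ) * R ≤ D * R ^ 2 := by
      gcongr
      nlinarith
    linarith
  have hx₀ := hx.1
  have hb₀ := hcoord ⟨d₁, by omega⟩ le_rfl (by rw [Fin.lt_def]; simp only; omega)
  have hb₁ := hcoord ⟨d₁ + 1, by omega⟩ (by simp) (by rw [Fin.lt_def]; simp only; omega)
  have hb₂ := hcoord ⟨(i : ℕ) - 1, by omega⟩ (by simp only; omega)
    (by rw [Fin.lt_def]; simp only; omega)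
  have hb₃ := hcoord i (by omega) hij
  refine ⟨?_, ?_, ?_⟩
  · have hrel := normCoord_relation hi b hx
    have hne : (c₁ : K) * (x i * x ⟨d₁, by omega⟩) ≠ 0 :=
      mul_ne_zero (Nat.cast_ne_zero.2 hc₁0) (mul_ne_zero hx.2.1 hx.1)
    refine (le_pow_of_norm_archPart_le (D := D * D) (mul_ne_zero hD hD)
      (mul_pos b.lam_pos (b.scale_pos d₁ i)) hne (R := (c₁ + c₂) * R ^ 2) ?_ ?_).trans ?_
    · rw [← hrel, map_sub, map_mul, map_mul, map_mul, map_mul, map_natCast, map_natCast]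
      exact sub_mem_denomDvd (natCast_mul_mem_denomDvd _ (mul_mem_denomDvd hb₃.1 hb₀.1))
        (natCast_mul_mem_denomDvd _ (mul_mem_denomDvd hb₁.1 hb₂.1))
    · rw [← hrel, map_sub, map_mul, map_mul, map_mul, map_mul, map_natCast, map_natCast]
      refine (norm_sub_le _ _).trans ?_
      rw [norm_natCast_mul, norm_natCast_mul, add_mul, sq]
      have hprod : ∀ v w : mixedSpace K, 1 + ‖v‖ ≤ R → 1 + ‖w‖ ≤ R → ‖v * w‖ ≤ R * R :=
        fun v w hv hw => (norm_mul_le v w).trans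
          (mul_le_mul (by linarith) (by linarith) (norm_nonneg _) (by linarith))
      exact add_le_add (mul_le_mul_of_nonneg_left (hprod _ _ hb₃.2 hb₀.2) (Nat.cast_nonneg _))
        (mul_le_mul_of_nonneg_left (hprod _ _ hb₁.2 hb₂.2) (Nat.cast_nonneg _))
    · refine pow_le_pow_left₀ (by positivity) ?_ _
      rw [← mul_assoc]
      gcongr
      linarith
  · obtain ⟨h0, -⟩ := normCoord_eq_majorantArg hi b hx (Units.mk0 _ hx₀) rfl
    rw [h0, majorantArg_zero, add_zero] at hb₀
    refine (le_pow_of_norm_archPart_le hD b.lam_pos hx₀ hb₀.1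
      (R := R) ((le_add_of_nonneg_left zero_le_one).trans hb₀.2)).trans ?_
    exact pow_le_pow_left₀ (by positivity) hDR _
  · refine (le_pow_of_norm_archPart_le hD (inv_pos.2 (b.scale_pos d₁ j)) xj.ne_zero hdual.1
      (R := R) ((le_add_of_nonneg_left zero_le_one).trans hdual.2)).trans ?_
    exact pow_le_pow_left₀ (by positivity) hDR _

/-- The form with `x₀` at position `d₁`, `y` at position `i`, the entries of `z` at the positions
from `i + 1` on, and zeros elsewhere. -/
def partialForm {K : Type*} [Field K] {d₁ : ℕ} (i : Fin (2 * d₁ + 1)) (x₀ y : K) {l : ℕ}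
    (z : Fin l → K) : Fin (2 * d₁ + 1) → K := fun r =>
  if (r : ℕ) = d₁ then x₀ else if r = i then y else
    if h : i < r ∧ (r : ℕ) - i - 1 < l then z ⟨(r : ℕ) - i - 1, h.2⟩ else 0

/-- Before position `s` a form in `stForms` coincides with the form built from those of its coordinates
that precede `s`; this makes the shift of the `s`-th coordinate a function of them. -/
theorem eq_partialForm {K : Type*} [Field K] {d₁ : ℕ} {i j : Fin (2 * d₁ + 1)}
    {x : Fin (2 * d₁ + 1) → K} (hx : x ∈ stForms K d₁ i j) {r s : Fin (2 * d₁ + 1)}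
    (hrs : r < s) {l : ℕ} {y : K} {z : Fin l → K} (hy : i < s → y = x i)
    (hz : ∀ m, i < m → m < s → ∃ h : (m : ℕ) - i - 1 < l, z ⟨(m : ℕ) - i - 1, h⟩ = x m) :
    x r = partialForm i (x ⟨d₁, by omega⟩) y z r := by
  rw [partialForm]
  split_ifs with h1 h2 h3
  · congr 1
    exact Fin.ext h1
  · rw [hy (h2 ▸ hrs), h2]
  · obtain ⟨h, h'⟩ := hz r h3.1 hrs
    exact h'.symm
  · by_contra h0
    rcases hx.2.2 r h0 with h | h
    · exact h1 h
    · have h4 : i < r := lt_of_le_of_ne h.1 (Ne.symm h2)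
      exact h3 ⟨h4, (hz r h4 hrs).1⟩

/-- A form in `stForms` is determined by its coordinates at `d₁`, `i` and strictly between `i`
and `j`. -/
theorem stForms_ext {K : Type*} [Field K] {d₁ : ℕ} {i j : Fin (2 * d₁ + 1)}
    {x y : Fin (2 * d₁ + 1) → K} (hx : x ∈ stForms K d₁ i j) (hy : y ∈ stForms K d₁ i j)
    (h₀ : x ⟨d₁, by omega⟩ = y ⟨d₁, by omega⟩) (hxyi : x i = y i)
    (h : ∀ r, i < r → r < j → x r = y r) : x = y := by
  funext r
  by_cases h1 : (r : ℕ) = d₁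
  · have : r = ⟨d₁, by omega⟩ := Fin.ext h1
    rw [this, h₀]
  by_cases h2 : r = i
  · rw [h2, hxyi]
  by_cases h3 : i < r ∧ r < j
  · exact h r h3.1 h3.2
  · have hzero : ∀ w ∈ stForms K d₁ i j, w r = 0 := by
      intro w hw
      by_contra h0
      rcases hw.2.2 r h0 with h | h
      · exact h1 h
      · exact h3 ⟨lt_of_le_of_ne h.1 (Ne.symm h2), h.2⟩
    rw [hzero x hx, hzero y hy]

theorem summable_and_norm_tsum_le {ι : Type*} {f : ι → ℂ} {B : ℝ} (hB : 0 ≤ B)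
    (h : ∑' p, ENNReal.ofReal ‖f p‖ ≤ ENNReal.ofReal B) :
    Summable f ∧ ‖∑' p, f p‖ ≤ B := by
  have hfin : ∀ s : Finset ι, ∑ p ∈ s, ‖f p‖ ≤ B := fun s => by
    have := (ENNReal.sum_le_tsum s).trans h
    rwa [← ENNReal.ofReal_sum_of_nonneg fun p _ => norm_nonneg _,
      ENNReal.ofReal_le_ofReal_iff hB] at this
  have hs : Summable fun p => ‖f p‖ := summable_of_sum_le (fun p => norm_nonneg _) hfin
  exact ⟨hs.of_norm, (norm_tsum_le_tsum_norm hs).trans (hs.tsum_le_of_sum_le hfin)⟩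

theorem summable_of_tsum_ofReal_ne_top {ι : Type*} {f : ι → ℝ} (hf : ∀ p, 0 ≤ f p)
    (h : ∑' p, ENNReal.ofReal (f p) ≠ ⊤) : Summable f := by
  refine summable_of_sum_le (c := (∑' p, ENNReal.ofReal (f p)).toReal) hf fun s => ?_
  rw [← ENNReal.ofReal_le_iff_le_toReal h, ENNReal.ofReal_sum_of_nonneg fun p _ => hf p]
  exact ENNReal.sum_le_tsum s

theorem inv_pow_le_decayWeight {D M : ℕ} {a : Adele K} {R : ℝ} (hfin : finPart K a ∈ denomDvd K D)
    (hR : 1 + ‖archPart K a‖ ≤ R) : (R ^ M)⁻¹ ≤ decayWeight D M a := by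
  rw [decayWeight_of_mem hfin]
  have := norm_nonneg (archPart K a)
  gcongr

end

/-! ### The estimate of the theta series -/

section

open scoped Classical ENNReal
open mixedEmbedding

variable {K : Type*} [Field K] [NumberField K]

/-- The numerical heart of the estimate: a large negative power of the common bound `R` pays for
the lattice sums over `x_i` and `x_j` and produces the powers of the two scales. -/
theorem inv_pow_le_of_scale_le {A R lam s sj N₁ N₂ : ℝ} {n : ℕ} (hA : 1 ≤ A) (hR : 1 ≤ R)
    (hlam : 0 < lam) (hs : 0 < s) (hsj : 0 < sj) (hN₁ : 1 ≤ N₁) (hN₂ : 1 ≤ N₂)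
    (h₁ : lam * s ≤ (A * R ^ 2) ^ n) (h₂ : lam ≤ (A * R ^ 2) ^ n) (h₃ : sj⁻¹ ≤ (A * R ^ 2) ^ n) :
    (R ^ (2 * n * (⌈N₁⌉₊ + ⌈N₂⌉₊)))⁻¹ ≤
      A ^ (n * (⌈N₁⌉₊ + ⌈N₂⌉₊)) * ((lam * s) ^ (-N₁) * sj ^ N₂) / (max 1 s⁻¹ * max 1 sj) := by
  set Q := (A * R ^ 2) ^ n with hQ
  have hQ1 : 1 ≤ Q := one_le_pow₀ (one_le_mul_of_one_le_of_one_le hA (one_le_pow₀ hR))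
  have hQN : ∀ N : ℝ, Q ^ N ≤ Q ^ ⌈N⌉₊ := fun N => by
    rw [← Real.rpow_natCast]
    exact Real.rpow_le_rpow_of_exponent_le hQ1 (Nat.le_ceil N)
  have hm₁ := max_one_inv_le_rpow hs hlam h₁ h₂ hN₁
  have hm₂ := max_one_inv_le_rpow (s := sj⁻¹) (lam := 1) (inv_pos.2 hsj) one_pos
    (by rwa [one_mul]) hQ1 hN₂
  rw [inv_inv, one_mul, Real.rpow_neg (inv_nonneg.2 hsj.le), Real.inv_rpow hsj.le, inv_inv] at hm₂
  have hk₁ : 0 ≤ (lam * s) ^ (-N₁) := Real.rpow_nonneg (mul_pos hlam hs).le _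
  have hk₂ : 0 ≤ sj ^ N₂ := Real.rpow_nonneg hsj.le _
  rw [le_div_iff₀ (by positivity), inv_mul_le_iff₀ (by positivity)]
  calc max 1 s⁻¹ * max 1 sj ≤ (Q ^ N₁ * (lam * s) ^ (-N₁)) * (Q ^ N₂ * sj ^ N₂) :=
        mul_le_mul hm₁ hm₂ (by positivity) (by positivity)
    _ ≤ (Q ^ ⌈N₁⌉₊ * (lam * s) ^ (-N₁)) * (Q ^ ⌈N₂⌉₊ * sj ^ N₂) := by
        gcongr
        exacts [hQN N₁, hQN N₂]
    _ = Q ^ (⌈N₁⌉₊ + ⌈N₂⌉₊) * ((lam * s) ^ (-N₁) * sj ^ N₂) := by rw [pow_add]; ring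
    _ = _ := by
        rw [hQ, ← pow_mul, mul_pow, ← pow_mul, ← mul_assoc 2 n]
        ring

/-- The estimate of the theta series, with the absolute convergence, for ideles in an arbitrary
compact set. -/
theorem exists_thetaSt_bound (ψ : AddChar (Adele K) Circle) {C : Set (Adele K)ˣ} (hC : IsCompact C)
    {d₁ : ℕ} {i j : Fin (2 * d₁ + 1)} (hi : d₁ + 2 ≤ (i : ℕ)) (hij : i < j)
    {Ψ : (Fin ((j : ℕ) - d₁ + 1) → Adele K) → ℂ} (hΨ : Ψ ∈ SchwartzBruhat K ((j : ℕ) - d₁ + 1)) :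
    ∃ Ψ' : (Fin 2 → Adele K) → ℝ,
      (fun y => (Ψ' y : ℂ)) ∈ SchwartzBruhat K 2 ∧ (∀ y, 0 ≤ Ψ' y) ∧
      (∀ b : BorelElt K, Summable fun x : Kˣ => Ψ' (majorantArg b x)) ∧
      ∀ N₁ N₂ : ℝ, 1 ≤ N₁ → 1 ≤ N₂ → ∃ c : ℝ, ∀ b : BorelElt K, b.t ∈ C → b.t₁ ∈ C → b.t₂ ∈ C →
        Summable (thetaTerm ψ i j Ψ b) ∧
        ‖thetaSt ψ i j Ψ b‖ ≤
          c * ((b.lam ^ 2 * b.mu ^ (2 * (d₁ : ℤ) - 2 * ((i : ℕ) : ℤ))) ^ (-N₁) *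
            (b.lam * b.mu ^ (2 * (d₁ : ℤ) - 2 * ((j : ℕ) : ℤ))) ^ N₂ *
            (∏ l ∈ Finset.Ioo (i : ℕ) (j : ℕ),
              max 1 (b.lam⁻¹ * b.mu ^ (2 * (l : ℤ) - 2 * (d₁ : ℤ)))) *
            ∑' x : Kˣ, Ψ' (majorantArg b x)) := by
  obtain ⟨D, hD, Ψ', hSB, hpos, hdec, hterm⟩ := exists_termwise_majorant hC hi hij hΨ
  obtain ⟨c₀, hc₀, hlat⟩ := exists_tsum_decayWeight_le (K := K) hD
  obtain ⟨A, hA, hsep⟩ := exists_scale_le (K := K) hD hi hij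
  have hij' : (i : ℕ) < j := hij
  have hj2 := j.2
  set n := Module.finrank ℚ K with hn
  have hsumm : ∀ b : BorelElt K, Summable fun x : Kˣ => Ψ' (majorantArg b x) := by
    intro b
    obtain ⟨c, hc, hle⟩ := hdec (2 * n)
    refine summable_of_tsum_ofReal_ne_top (fun x => hpos _) (ne_top_of_le_ne_top
      (ENNReal.mul_ne_top (ENNReal.ofReal_ne_top (r := c)) ((hlat b.lam b.lam_pos 0).trans_lt
        ENNReal.ofReal_lt_top).ne) ?_)
    rw [← ENNReal.tsum_mul_left]
    refine le_trans (ENNReal.tsum_le_tsum fun x => ?_)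
      (ENNReal.tsum_comp_le_tsum_of_injective (f := fun x : Kˣ => (x : K))
        (fun _ _ h => Units.ext h) _)
    rw [← ENNReal.ofReal_mul hc, ← majorantArg_zero]
    exact ENNReal.ofReal_le_ofReal (hle _)
  refine ⟨Ψ', hSB, hpos, hsumm, fun N₁ N₂ hN₁ hN₂ => ?_⟩
  set q : ℕ := j - i - 1 with hq
  set e : ℕ := ⌈N₁⌉₊ + ⌈N₂⌉₊ with he
  -- the power `2 n e` of `R` yields the powers of the two scales; `q + 2` further powers `2 n` serve the
  -- sums over `x_i`, over the `q` coordinates between `i` and `j`, and over `x_j`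
  obtain ⟨c, hc, hbound⟩ := hterm (2 * n * e + 2 * n * (q + 2))
  refine ⟨c * A ^ (n * e) * c₀ ^ (q + 2), fun b hb hb₁ hb₂ => ?_⟩
  set s := b.scale d₁ i with hs
  set sj := b.scale d₁ j with hsj
  have hs0 : 0 < s := b.scale_pos d₁ i
  have hsj0 : 0 < sj := b.scale_pos d₁ j
  have hl0 := b.lam_pos
  set S := ∑' x : Kˣ, Ψ' (majorantArg b x) with hS
  have hS0 : 0 ≤ S := tsum_nonneg fun x => hpos _
  set k := (b.lam * s) ^ (-N₁) * sj ^ N₂ with hk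
  have hk0 : 0 ≤ k := mul_nonneg (Real.rpow_nonneg (mul_pos hl0 hs0).le _)
    (Real.rpow_nonneg hsj0.le _)
  have hprod : ∏ l ∈ Finset.Ioo (i : ℕ) (j : ℕ),
      max 1 (b.lam⁻¹ * b.mu ^ (2 * (l : ℤ) - 2 * (d₁ : ℤ))) =
      ∏ l ∈ Finset.range q, max 1 (b.scale d₁ (i + 1 + l))⁻¹ := by
    have hIoo : Finset.Ioo (i : ℕ) (j : ℕ) = Finset.Ico ((i : ℕ) + 1) j := by
      ext l
      simp only [Finset.mem_Ioo, Finset.mem_Ico]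
      omega
    rw [hIoo, Finset.prod_Ico_eq_prod_range]
    refine Finset.prod_congr (by rw [hq]; congr 1) fun l _ => ?_
    rw [BorelElt.scale, mul_inv, ← zpow_neg, neg_sub]
  have hlams : b.lam ^ 2 * b.mu ^ (2 * (d₁ : ℤ) - 2 * ((i : ℕ) : ℤ)) = b.lam * s := by
    rw [hs, BorelElt.scale]; ring
  rw [hprod, hlams]
  change Summable _ ∧ _ ≤ _ * (k * _ * S)
  -- the weights of the coordinates `i`, `i + 1 + l` and of the dual variable `x_j`
  let wI : K → K → ℝ := fun x₀ y => decayWeight D (2 * n)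
    (((realIdele K s hs0 : (Adele K)ˣ) : Adele K) * (algebraMap K (Adele K) y +
      unipShift b.u (toAdelic (partialForm i x₀ 0 (Fin.elim0 : Fin 0 → K))) i))
  let wP : K → K → (l : ℕ) → (Fin l → K) → K → ℝ := fun x₀ y l z w => decayWeight D (2 * n)
    (((realIdele K (b.scale d₁ (i + 1 + l)) (b.scale_pos d₁ (i + 1 + l)) : (Adele K)ˣ) : Adele K) *
      (algebraMap K (Adele K) w +
        unipShift b.u (toAdelic (partialForm i x₀ y z)) (Fin.ofNat (2 * d₁ + 1) (i + 1 + l))))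
  let wV : K → ℝ := fun v => decayWeight D (2 * n) (b.normDual d₁ j v)
  have hwP0 : ∀ x₀ y l z w, 0 ≤ wP x₀ y l z w := fun _ _ _ _ _ => decayWeight_nonneg _ _ _
  have hI : ∀ x₀, ∑' y, ENNReal.ofReal (wI x₀ y) ≤ ENNReal.ofReal (c₀ * max 1 s⁻¹) :=
    fun x₀ => hlat s hs0 _
  have hV : ∑' v, ENNReal.ofReal (wV v) ≤ ENNReal.ofReal (c₀ * max 1 sj) := by
    have := hlat sj⁻¹ (inv_pos.2 hsj0) 0
    rw [inv_inv] at this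
    simp only [add_zero] at this
    exact this
  have hP : ∀ x₀ y, ∑' z : Fin q → K, ∏ l : Fin q,
      ENNReal.ofReal (wP x₀ y l (fun m => z (m.castLE l.2.le)) (z l)) ≤
      ∏ l ∈ Finset.range q, ENNReal.ofReal (c₀ * max 1 (b.scale d₁ (i + 1 + l))⁻¹) :=
    fun x₀ y => tsum_triangular_prod_le (fun l z w => ENNReal.ofReal (wP x₀ y l z w)) _
      (fun l z => hlat _ _ _) q
  let G : Kˣ × K × (Fin q → K) × K → ℝ≥0∞ := fun g => ENNReal.ofReal (Ψ' (majorantArg b g.1)) *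
    (ENNReal.ofReal (wI g.1 g.2.1) * ((∏ l : Fin q, ENNReal.ofReal
      (wP g.1 g.2.1 l (fun m => g.2.2.1 (m.castLE l.2.le)) (g.2.2.1 l))) *
        ENNReal.ofReal (wV g.2.2.2)))
  have hG : ∑' g, G g ≤ ENNReal.ofReal (S * (c₀ * max 1 s⁻¹ *
      ((∏ l ∈ Finset.range q, c₀ * max 1 (b.scale d₁ (i + 1 + l))⁻¹) * (c₀ * max 1 sj)))) := by
    rw [ENNReal.ofReal_mul hS0, ENNReal.ofReal_mul (by positivity), ENNReal.ofReal_mul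
      (Finset.prod_nonneg fun l _ => by positivity), ENNReal.ofReal_prod_of_nonneg
      (fun l _ => by positivity), hS, ENNReal.ofReal_tsum_of_nonneg (fun x => hpos _) (hsumm b)]
    simp only [G]
    rw [ENNReal.tsum_prod', ← ENNReal.tsum_mul_right]
    refine ENNReal.tsum_le_tsum fun x₀ => ?_
    dsimp only
    rw [ENNReal.tsum_mul_left]
    refine mul_le_mul_right ?_ _
    rw [ENNReal.tsum_prod']
    refine le_trans (ENNReal.tsum_le_tsum fun y => ?_) (le_trans (le_of_eq
      (ENNReal.tsum_mul_right (f := fun y => ENNReal.ofReal (wI x₀ y)))) (mul_le_mul_left (hI x₀) _))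
    dsimp only
    rw [ENNReal.tsum_mul_left]
    refine mul_le_mul_right ?_ _
    rw [ENNReal.tsum_prod']
    refine le_trans (ENNReal.tsum_le_tsum fun z => ?_) (le_trans (le_of_eq
      (ENNReal.tsum_mul_right)) (mul_le_mul_left (hP x₀ y) _))
    dsimp only
    rw [ENNReal.tsum_mul_left]
    exact mul_le_mul_right hV _
  -- the coordinates that determine a pair `(x, x_j)`
  let coords : stForms K d₁ i j × Kˣ → Kˣ × K × (Fin q → K) × K := fun p =>
    (Units.mk0 (p.1.1 ⟨d₁, by omega⟩) p.1.2.1, p.1.1 i,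
      fun m => p.1.1 ⟨i + 1 + m, by have := m.2; omega⟩, (p.2 : K))
  have hinj : Function.Injective coords := by
    rintro ⟨⟨x, hx⟩, xj⟩ ⟨⟨x', hx'⟩, xj'⟩ h
    simp only [coords, Prod.mk.injEq, Units.mk0_inj] at h
    refine Prod.ext (Subtype.ext (stForms_ext hx hx' h.1 h.2.1 fun r hir hrj => ?_))
      (Units.ext h.2.2.2)
    have hir' : (i : ℕ) < r := hir
    have hrj' : (r : ℕ) < j := hrj
    have h1 := congrFun h.2.2.1 ⟨(r : ℕ) - i - 1, by omega⟩
    have h2 : (⟨(i : ℕ) + 1 + ((r : ℕ) - i - 1), by omega⟩ : Fin (2 * d₁ + 1)) = r :=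
      Fin.ext (by simp only; omega)
    simpa only [h2] using h1
  have hpt : ∀ p, ENNReal.ofReal ‖thetaTerm ψ i j Ψ b p‖ ≤
      ENNReal.ofReal (c * (A ^ (n * e) * k / (max 1 s⁻¹ * max 1 sj))) * G (coords p) := by
    rintro ⟨⟨x, hx⟩, xj⟩
    rw [thetaTerm, norm_mul, Circle.norm_coe, mul_one]
    by_cases hne : Ψ (thetaArg j b x xj) = 0
    · simp [hne]
    obtain ⟨R, hR, hcoord, hdual, hle⟩ := hbound b hb hb₁ hb₂ x hx xj (Units.mk0 _ hx.1) rfl hne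
    obtain ⟨hsep₁, hsep₂, hsep₃⟩ := hsep b x hx xj R hR hcoord hdual
    have hRk := inv_pow_le_of_scale_le hA hR hl0 hs0 hsj0 hN₁ hN₂ hsep₁ hsep₂ hsep₃
    have hlI : (R ^ (2 * n))⁻¹ ≤ wI (x ⟨d₁, by omega⟩) (x i) := by
      have h := hcoord i (by omega) hij
      have heq : unipShift b.u (toAdelic (partialForm i (x ⟨d₁, by omega⟩) 0
          (Fin.elim0 : Fin 0 → K))) i = unipShift b.u (toAdelic x) i :=
        unipShift_congr _ fun l hl => by
          rw [toAdelic, toAdelic, eq_partialForm hx hl (fun h => absurd h (lt_irrefl _))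
            fun m h h' => absurd (h.trans h') (lt_irrefl _)]
      simp only [wI, heq]
      exact inv_pow_le_decayWeight h.1 h.2
    have hlP : ∀ l : Fin q, (R ^ (2 * n))⁻¹ ≤ wP (x ⟨d₁, by omega⟩) (x i) l
        (fun m => x ⟨i + 1 + m, by have := m.2; have := l.2; omega⟩)
        (x ⟨i + 1 + l, by have := l.2; omega⟩) := by
      intro l
      have hl := l.2
      have hpos' : Fin.ofNat (2 * d₁ + 1) (i + 1 + l) =
          (⟨i + 1 + l, by omega⟩ : Fin (2 * d₁ + 1)) :=
        Fin.ext (Nat.mod_eq_of_lt (by omega))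
      have h := hcoord ⟨i + 1 + l, by omega⟩ (by simp only; omega)
        (by rw [Fin.lt_def]; simp only; omega)
      have heq : unipShift b.u (toAdelic (partialForm i (x ⟨d₁, by omega⟩) (x i)
          (fun m : Fin l => x ⟨i + 1 + m, by have := m.2; omega⟩))) ⟨i + 1 + l, by omega⟩ =
          unipShift b.u (toAdelic x) ⟨i + 1 + l, by omega⟩ :=
        unipShift_congr _ fun r hr => by
          rw [toAdelic, toAdelic, eq_partialForm hx hr (fun _ => rfl) fun m h h' => ?_]
          have h1 : (i : ℕ) < m := h
          have h2 : (m : ℕ) < i + 1 + l := h'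
          refine ⟨by omega, ?_⟩
          congr 1
          exact Fin.ext (by simp only; omega)
      simp only [wP, hpos', heq]
      exact inv_pow_le_decayWeight h.1 h.2
    have hlV : (R ^ (2 * n))⁻¹ ≤ wV xj := inv_pow_le_decayWeight hdual.1 hdual.2
    have hreal : ‖Ψ (thetaArg j b x xj)‖ ≤
        c * (A ^ (n * e) * k / (max 1 s⁻¹ * max 1 sj)) *
        (Ψ' (majorantArg b (Units.mk0 _ hx.1)) * (wI (x ⟨d₁, by omega⟩) (x i) *
          ((∏ l : Fin q, wP (x ⟨d₁, by omega⟩) (x i) l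
            (fun m => x ⟨i + 1 + m, by have := m.2; have := l.2; omega⟩)
            (x ⟨i + 1 + l, by have := l.2; omega⟩)) * wV xj))) := by
      refine hle.trans ?_
      have hRinv : 0 ≤ (R ^ (2 * n))⁻¹ := by positivity
      have hprodle : ((R ^ (2 * n))⁻¹) ^ q ≤ ∏ l : Fin q, wP (x ⟨d₁, by omega⟩) (x i) l
            (fun m => x ⟨i + 1 + m, by have := m.2; have := l.2; omega⟩)
            (x ⟨i + 1 + l, by have := l.2; omega⟩) := by
        rw [show ((R ^ (2 * n))⁻¹) ^ q = ∏ _l : Fin q, (R ^ (2 * n))⁻¹ by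
          rw [Finset.prod_const, Finset.card_univ, Fintype.card_fin]]
        exact Finset.prod_le_prod (fun _ _ => hRinv) fun l _ => hlP l
      have hsplit : (R ^ (2 * n * e + 2 * n * (q + 2)))⁻¹ = (R ^ (2 * n * e))⁻¹ *
          ((R ^ (2 * n))⁻¹ * (((R ^ (2 * n))⁻¹) ^ q * (R ^ (2 * n))⁻¹)) := by
        rw [pow_add, mul_inv, pow_mul R (2 * n) (q + 2), ← inv_pow (R ^ (2 * n)), pow_add]
        ring
      rw [hsplit]
      have h0 := hpos (majorantArg b (Units.mk0 _ hx.1))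
      have hmul := mul_le_mul hRk (mul_le_mul hlI (mul_le_mul hprodle hlV hRinv
        (Finset.prod_nonneg fun l _ => hwP0 _ _ _ _ _)) (by positivity)
        (decayWeight_nonneg _ _ _)) (by positivity) (by positivity)
      have := mul_le_mul_of_nonneg_left (mul_le_mul_of_nonneg_left hmul hc) h0
      refine le_trans (le_of_eq ?_) (this.trans (le_of_eq ?_)) <;> ring
    refine (ENNReal.ofReal_le_ofReal hreal).trans (le_of_eq ?_)
    rw [ENNReal.ofReal_mul (by positivity), ENNReal.ofReal_mul (hpos _), ENNReal.ofReal_mul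
      (decayWeight_nonneg _ _ _), ENNReal.ofReal_mul
      (Finset.prod_nonneg fun l _ => hwP0 _ _ _ _ _), ENNReal.ofReal_prod_of_nonneg
      (fun l _ => hwP0 _ _ _ _ _)]
    rfl
  refine summable_and_norm_tsum_le (by positivity) ?_
  calc _ ≤ ∑' p, ENNReal.ofReal (c * (A ^ (n * e) * k / (max 1 s⁻¹ * max 1 sj))) * G (coords p) :=
        ENNReal.tsum_le_tsum hpt
    _ ≤ ENNReal.ofReal (c * (A ^ (n * e) * k / (max 1 s⁻¹ * max 1 sj))) * ∑' g, G g := by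
        rw [ENNReal.tsum_mul_left]
        exact mul_le_mul_right (ENNReal.tsum_comp_le_tsum_of_injective hinj G) _
    _ ≤ _ := mul_le_mul_right hG _
    _ = _ := by
        rw [← ENNReal.ofReal_mul (by positivity)]
        congr 1
        rw [Finset.prod_mul_distrib, Finset.prod_const, Finset.card_range]
        have h1 : (max 1 s⁻¹) ≠ 0 := by positivity
        have h2 : (max 1 sj) ≠ 0 := by positivity
        field_simp
        ring

end

end

end ShintaniGL2

theorem mainTheorem3 (K : Type*) [Field K] [NumberField K]
    (ψ : AddChar (ShintaniGL2.Adele K) Circle) (hψ_cont : Continuous ψ) (hψ_nontrivial : ψ ≠ 1)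
    (hψ_K : ∀ x : K, ψ (algebraMap K (ShintaniGL2.Adele K) x) = 1)
    (C : Set (ShintaniGL2.Adele K)ˣ) (hC_compact : IsCompact C)
    (hC_norm : C ⊆ ShintaniGL2.normOneIdeles K)
    (hC_surj : ∀ a ∈ ShintaniGL2.normOneIdeles K, ∃ x : Kˣ, ∃ c ∈ C,
      a = ShintaniGL2.principalIdele x * c)
    (d₁ : ℕ) (i j : Fin (2 * d₁ + 1)) (hi : d₁ + 2 ≤ (i : ℕ)) (hij : i < j)
    (Ψ : (Fin ((j : ℕ) - d₁ + 1) → ShintaniGL2.Adele K) → ℂ)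
    (hΨ : Ψ ∈ ShintaniGL2.SchwartzBruhat K ((j : ℕ) - d₁ + 1)) :
    (∀ b : ShintaniGL2.BorelElt K, Summable (ShintaniGL2.thetaTerm ψ i j Ψ b)) ∧
    ∃ Ψ' : (Fin 2 → ShintaniGL2.Adele K) → ℝ,
      (fun y => (Ψ' y : ℂ)) ∈ ShintaniGL2.SchwartzBruhat K 2 ∧ (∀ y, 0 ≤ Ψ' y) ∧
      (∀ b : ShintaniGL2.BorelElt K, Summable fun x : Kˣ => Ψ' (ShintaniGL2.majorantArg b x)) ∧
      ∀ N₁ N₂ : ℝ, 1 ≤ N₁ → 1 ≤ N₂ → ∃ c : ℝ, ∀ b : ShintaniGL2.BorelElt K,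
        b.t ∈ C → b.t₁ ∈ C → b.t₂ ∈ C →
        ‖ShintaniGL2.thetaSt ψ i j Ψ b‖ ≤
          c * ((b.lam ^ 2 * b.mu ^ (2 * (d₁ : ℤ) - 2 * ((i : ℕ) : ℤ))) ^ (-N₁) *
            (b.lam * b.mu ^ (2 * (d₁ : ℤ) - 2 * ((j : ℕ) : ℤ))) ^ N₂ *
            (∏ l ∈ Finset.Ioo (i : ℕ) (j : ℕ),
              max 1 (b.lam⁻¹ * b.mu ^ (2 * (l : ℤ) - 2 * (d₁ : ℤ)))) *
            ∑' x : Kˣ, Ψ' (ShintaniGL2.majorantArg b x)) := by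
  refine ⟨fun b => ?_, ?_⟩
  · -- a single `b̃` is covered by the finite, hence compact, set of its own ideles
    have hfin : IsCompact ({b.t, b.t₁, b.t₂} : Set (ShintaniGL2.Adele K)ˣ) :=
      (Set.toFinite _).isCompact
    obtain ⟨Ψ', -, -, -, h⟩ := ShintaniGL2.exists_thetaSt_bound ψ hfin hi hij hΨ
    obtain ⟨c, hc⟩ := h 1 1 le_rfl le_rfl
    exact (hc b (by simp) (by simp) (by simp)).1
  · obtain ⟨Ψ', hSB, hpos, hsumm, h⟩ := ShintaniGL2.exists_thetaSt_bound ψ hC_compact hi hij hΨ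
    refine ⟨Ψ', hSB, hpos, hsumm, fun N₁ N₂ hN₁ hN₂ => ?_⟩
    obtain ⟨c, hc⟩ := h N₁ N₂ hN₁ hN₂
    exact ⟨c, fun b hb hb₁ hb₂ => (hc b hb hb₁ hb₂).2⟩
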